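/- **Setting.** Let $A$ be a finite alphabet with at least two letters (discrete topology). A subshift is a closed set $X\subset A^{\mathbb N}$ (product topology) with $\sigma(X)\subset X$, where $\sigma$ is the left shift; $\mathcal L_2(X)$ denotes the set of two-letter words occurring in points of $X$. For $S\subset A^2$ let $Z=\{x\in A^{\mathbb N}: (x_n,x_{n+1})\in S \text{ for all } n\}$ be the topological Markov chain defined by $S$. A *conformal graph directed Markov system* over $A$ defined by $Z$ consists of a non-empty compact set $Y\subset\mathbb R^d$, non-empty compact sets $Y_e\subset Y$ $(e\in A)$ and injective maps $\phi_e:Y_e\to Y$, all Lipschitz with a common constant $s<1$, such that $\phi_f(Y_f)\subset Y_e$ whenever $ef\in\mathcal L_2(Z)$, and: 1. each $Y_e$ is connected and is the closure of its interior; 2. $\phi_e(\operatorname{Int}Y_e)\cap\phi_f(\operatorname{Int}Y_f)=\emptyset$ for $e\neq f$; 3. there are connected open sets $W_f\supset Y_f$ $(f\in A)$ such that each $\phi_f$ extends to a $C^1$ conformal diffeomorphism of $W_f$ into $\bigcap_{e:\,ef\in\mathcal L_2(Z)}W_e$; 4. there are $L\ge1$ and $\alpha>0$ with $\bigl||\phi_e'(x)|-|\phi_e'(y)|\bigr|\le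 L\,\|(\phi_e')^{-1}\|^{-1}|x-y|^\alpha$ for all $e\in A$ and $x,y\in Y_e$, where $|\cdot|$ is the operator norm of the derivative and $\|\cdot\|$ the supremum of such norms over $Y_e$; 5. there are $0<\gamma<\pi/2$ and $l>0$ such that every $x\in Y$ is the vertex of an open cone of central angle $\gamma$ and altitude $l$ contained in $\operatorname{Int}Y$. For $\omega\in Z$ let $\pi(\omega)$ be the unique point of $\bigcap_{n\ge1}\phi_{\omega_1}\circ\cdots\circ\phi_{\omega_n}(Y_{\omega_n})$, and for $X\subset Z$ let $J(X)=\pi(X)$. Let $HD$ denote Hausdorff dimension (with $HD(\emptyset)=0$). **Theorem.** For every conformal graph directed Markov system over a finite alphabet, defined by a topological Markov chain $Z$, $$\{HD(J(X)) : X\subset Z \text{ a subshift}\}=[0,HD(J(Z))].$$ Moreover, if $Z\neq\emptyset$, every value in $[0,HD(J(Z))]$ is attained by a non-empty subshift $X\subset Z$. -/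

import Mathlib

open Set
open scoped NNReal ENNReal

namespace ShiftGenerated

/-! ### Symbolic dynamics -/

section Symbolic

variable {A : Type*}

/-- The left shift on one-sided sequences. -/
def shift (x : ℕ → A) : ℕ → A := fun n => x (n + 1)

/-- A subshift: a closed shift-invariant set of sequences (the topology on `ℕ → A` is the product
topology, and in all uses the topology on `A` is discrete). -/
def IsSubshift [TopologicalSpace A] (X : Set (ℕ → A)) : Prop :=
  IsClosed X ∧ ∀ x ∈ X, shift x ∈ X

/-- The topological Markov chain with set of adjacencies `S`. -/
def markovChain (S : Set (A × A)) : Set (ℕ → A) :=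
  {x | ∀ n, (x n, x (n + 1)) ∈ S}

/-- The language of `X`: all non-empty finite words occurring in points of `X`. -/
def language (X : Set (ℕ → A)) : Set (List A) :=
  {w | ∃ x ∈ X, ∃ k n : ℕ, w = List.ofFn (fun i : Fin (n + 1) => x (k + i))}

/-- The word consisting of the first `n` letters of `x`. -/
def firstLetters (x : ℕ → A) (n : ℕ) : List A := List.ofFn (fun i : Fin n => x i)

theorem isSubshift_markovChain [TopologicalSpace A] [DiscreteTopology A] (S : Set (A × A)) :
    IsSubshift (markovChain S) := by
  refine ⟨?_, fun x hx n => hx (n + 1)⟩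
  have : markovChain S = ⋂ n : ℕ, (fun x : ℕ → A => (x n, x (n + 1))) ⁻¹' S := by
    ext x
    simp [markovChain]
  rw [this]
  exact isClosed_iInter fun n => (isClosed_discrete S).preimage (by fun_prop)

theorem pair_mem_language {X : Set (ℕ → A)} {x : ℕ → A} (hx : x ∈ X) (n : ℕ) :
    [x n, x (n + 1)] ∈ language X :=
  ⟨x, hx, n, 1, by simp [List.ofFn_succ]⟩

theorem firstLetters_succ (x : ℕ → A) (n : ℕ) :
    firstLetters x (n + 1) = x 0 :: firstLetters (shift x) n := by
  simp [firstLetters, shift, List.ofFn_succ]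

end Symbolic

/-! ### Shift-generated iterated constructions -/

/-- A shift-generated iterated construction over the alphabet `A`, generated by `X`, whose compact
metric space `Y` is realized as a subset of a metric space `E`. The generator `φ e` is a map
`piece e → Y`; its values outside `piece e` are irrelevant. -/
structure Construction {A : Type*} (X : Set (ℕ → A)) (E : Type*) [MetricSpace E] where
  /-- the underlying compact space -/
  Y : Set E
  nonempty_Y : Y.Nonempty
  isCompact_Y : IsCompact Y
  /-- the domains `Y_e` of the generators -/
  piece : A → Set E
  nonempty_piece : ∀ e, (piece e).Nonempty
  isCompact_piece : ∀ e, IsCompact (piece e)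
  piece_subset : ∀ e, piece e ⊆ Y
  /-- the generators -/
  φ : A → E → E
  mapsTo_φ : ∀ e, MapsTo (φ e) (piece e) Y
  injOn_φ : ∀ e, InjOn (φ e) (piece e)
  contracting : ∃ s : ℝ≥0, s < 1 ∧ ∀ e, LipschitzOnWith s (φ e) (piece e)
  mapsTo_piece : ∀ e f, [e, f] ∈ language X → MapsTo (φ f) (piece f) (piece e)

namespace Construction

variable {A : Type*} {X : Set (ℕ → A)} {E : Type*} [MetricSpace E]

/-- The composition `φ_{w₁} ∘ ⋯ ∘ φ_{wₙ}` along a word. -/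
def wordMap (Φ : Construction X E) : List A → E → E
  | [] => id
  | a :: w => Φ.φ a ∘ Φ.wordMap w

/-- The set `φ_{ω|n}(Y_{ω|n})` for `ω|n` the word of the first `n + 1` letters of `ω`,
whose last letter is `ω n` as sequences are indexed from `0`. -/
def cylinder (Φ : Construction X E) (ω : ℕ → A) (n : ℕ) : Set E :=
  Φ.wordMap (firstLetters ω (n + 1)) '' Φ.piece (ω n)

theorem cylinder_zero (Φ : Construction X E) (ω : ℕ → A) :
    Φ.cylinder ω 0 = Φ.φ (ω 0) '' Φ.piece (ω 0) := by
  simp [cylinder, firstLetters, wordMap]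

theorem cylinder_succ (Φ : Construction X E) (ω : ℕ → A) (n : ℕ) :
    Φ.cylinder ω (n + 1) = Φ.φ (ω 0) '' Φ.cylinder (shift ω) n := by
  rw [cylinder, firstLetters_succ, wordMap, image_comp]
  rfl

theorem cylinder_subset (Φ : Construction X E) (n : ℕ) (ω : ℕ → A)
    (h : ∀ k, [ω k, ω (k + 1)] ∈ language X) :
    Φ.cylinder ω (n + 1) ⊆ Φ.cylinder ω n := by
  induction n generalizing ω with
  | zero =>
    rw [cylinder_succ, cylinder_zero, cylinder_zero]
    exact image_mono (Φ.mapsTo_piece _ _ (h 0)).image_subset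
  | succ n ih =>
    rw [cylinder_succ, cylinder_succ Φ ω n]
    exact image_mono (ih (shift ω) fun k => h (k + 1))

theorem cylinder_shift_subset (Φ : Construction X E) (n : ℕ) (ω : ℕ → A)
    (h : ∀ k, [ω k, ω (k + 1)] ∈ language X) :
    Φ.cylinder (shift ω) n ⊆ Φ.piece (ω 0) := by
  induction n with
  | zero =>
    rw [cylinder_zero]
    exact (Φ.mapsTo_piece _ _ (h 0)).image_subset
  | succ n ih => exact (Φ.cylinder_subset n _ fun k => h (k + 1)).trans ih

theorem isCompact_cylinder (Φ : Construction X E) (n : ℕ) (ω : ℕ → A)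
    (h : ∀ k, [ω k, ω (k + 1)] ∈ language X) : IsCompact (Φ.cylinder ω n) := by
  obtain ⟨s, -, hs⟩ := Φ.contracting
  induction n generalizing ω with
  | zero =>
    rw [cylinder_zero]
    exact (Φ.isCompact_piece _).image_of_continuousOn (hs _).continuousOn
  | succ n ih =>
    rw [cylinder_succ]
    exact (ih (shift ω) fun k => h (k + 1)).image_of_continuousOn
      ((hs _).continuousOn.mono (Φ.cylinder_shift_subset n ω h))

theorem ediam_image_le_of_lipschitzOnWith {s : ℝ≥0} {f : E → E} {t : Set E}
    (hf : LipschitzOnWith s f t) : Metric.ediam (f '' t) ≤ s * Metric.ediam t := by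
  refine Metric.ediam_le ?_
  rintro _ ⟨x, hx, rfl⟩ _ ⟨y, hy, rfl⟩
  exact (hf hx hy).trans (by gcongr; exact Metric.edist_le_ediam_of_mem hx hy)

theorem ediam_cylinder_le (Φ : Construction X E) {s : ℝ≥0}
    (hs : ∀ e, LipschitzOnWith s (Φ.φ e) (Φ.piece e)) (n : ℕ) (ω : ℕ → A)
    (h : ∀ k, [ω k, ω (k + 1)] ∈ language X) :
    Metric.ediam (Φ.cylinder ω n) ≤ (s : ℝ≥0∞) ^ (n + 1) * Metric.ediam Φ.Y := by
  induction n generalizing ω with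
  | zero =>
    rw [cylinder_zero, zero_add, pow_one]
    exact (ediam_image_le_of_lipschitzOnWith (hs _)).trans
      (by gcongr; exact Φ.piece_subset _)
  | succ n ih =>
    rw [cylinder_succ, pow_succ', mul_assoc]
    exact (ediam_image_le_of_lipschitzOnWith
      ((hs _).mono (Φ.cylinder_shift_subset n ω h))).trans
      (by gcongr; exact ih (shift ω) fun k => h (k + 1))

/-- Along a point of `X` the intersection of the cylinders is a singleton. -/
theorem exists_iInter_cylinder_eq (Φ : Construction X E) {ω : ℕ → A} (hω : ω ∈ X) :
    ∃ x, ⋂ n, Φ.cylinder ω n = {x} := by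
  have h : ∀ k, [ω k, ω (k + 1)] ∈ language X := pair_mem_language hω
  have hne : (⋂ n, Φ.cylinder ω n).Nonempty :=
    IsCompact.nonempty_iInter_of_sequence_nonempty_isCompact_isClosed _
      (fun n => Φ.cylinder_subset n ω h) (fun n => (Φ.nonempty_piece _).image _)
      (Φ.isCompact_cylinder 0 ω h) (fun n => (Φ.isCompact_cylinder n ω h).isClosed)
  have hsub : (⋂ n, Φ.cylinder ω n).Subsingleton := by
    obtain ⟨s, hs1, hs⟩ := Φ.contracting
    rw [← Metric.ediam_eq_zero_iff]
    have hY : Metric.ediam Φ.Y ≠ ⊤ := Φ.isCompact_Y.isBounded.ediam_ne_top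
    have h0 : Filter.Tendsto (fun n : ℕ => (s : ℝ≥0∞) ^ (n + 1) * Metric.ediam Φ.Y)
        Filter.atTop (nhds 0) := by
      have h1 := (ENNReal.tendsto_pow_atTop_nhds_zero_of_lt_one
        (ENNReal.coe_lt_one_iff.2 hs1)).comp (Filter.tendsto_add_atTop_nat 1)
      simpa using ENNReal.Tendsto.mul_const h1 (Or.inr hY)
    exact le_antisymm (ge_of_tendsto' h0 fun n =>
      (Metric.ediam_mono (iInter_subset _ n)).trans (Φ.ediam_cylinder_le hs n ω h)) bot_le
  obtain ⟨x, hx⟩ := hne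
  exact ⟨x, hsub.eq_singleton_of_mem hx⟩

/-- The coding map `π : X → Y`, `{π ω} = ⋂ₙ φ_{ω|n}(Y_{ω|n})`. -/
noncomputable def coding (Φ : Construction X E) (ω : X) : E :=
  (Φ.exists_iInter_cylinder_eq ω.2).choose

theorem iInter_cylinder (Φ : Construction X E) (ω : X) :
    ⋂ n, Φ.cylinder ω n = {Φ.coding ω} :=
  (Φ.exists_iInter_cylinder_eq ω.2).choose_spec

/-- The limit set `J(X') = π(X')` of the subsystem generated by `X' ⊆ X`; for `X' = X` it is the
limit set of the construction itself. -/
def limitSet (Φ : Construction X E) (X' : Set (ℕ → A)) : Set E :=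
  Φ.coding '' {ω : X | (ω : ℕ → A) ∈ X'}

end Construction

/-! ### Conformal constructions -/

/-- The open cone in `ℝ^d` with vertex `x`, axis in the direction of the unit vector `u`, central
(full apex) angle `γ < π / 2` and altitude `l`. -/
def openCone {d : ℕ} (x u : EuclideanSpace ℝ (Fin d)) (γ l : ℝ) :
    Set (EuclideanSpace ℝ (Fin d)) :=
  {y | ‖y - x‖ * Real.cos (γ / 2) < inner ℝ (y - x) u ∧ inner ℝ (y - x) u < l}

/-- Conformality of a shift-generated iterated construction in `ℝ^d`. -/
structure Construction.IsConformal {A : Type*} {X : Set (ℕ → A)} {d : ℕ}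
    (Φ : Construction X (EuclideanSpace ℝ (Fin d))) : Prop where
  isConnected_piece : ∀ e, IsConnected (Φ.piece e)
  closure_interior_piece : ∀ e, closure (interior (Φ.piece e)) = Φ.piece e
  /-- open set condition -/
  openSet : ∀ e f, e ≠ f →
    Disjoint (Φ.φ e '' interior (Φ.piece e)) (Φ.φ f '' interior (Φ.piece f))
  /-- `ψ f` is the `C¹` conformal diffeomorphic extension of `φ f` to `W f`; its derivative on
  `piece f` does not depend on the choice of the extension, since `piece f` is the closure of its
  interior. The last clause is the Hölder condition on the norms of the derivatives, in which
  `‖(φ_e')⁻¹‖` is the supremum norm over `piece e`. -/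
  extension : ∃ (W : A → Set (EuclideanSpace ℝ (Fin d)))
      (ψ : A → EuclideanSpace ℝ (Fin d) → EuclideanSpace ℝ (Fin d)),
    (∀ f, IsOpen (W f) ∧ IsConnected (W f) ∧ Φ.piece f ⊆ W f ∧
      EqOn (ψ f) (Φ.φ f) (Φ.piece f) ∧
      ContDiffOn ℝ 1 (ψ f) (W f) ∧ (∀ x ∈ W f, ConformalAt (ψ f) x) ∧ InjOn (ψ f) (W f) ∧
      ∀ e, [e, f] ∈ language X → MapsTo (ψ f) (W f) (W e)) ∧
    ∃ L α : ℝ, 1 ≤ L ∧ 0 < α ∧ ∀ e, ∀ x ∈ Φ.piece e, ∀ y ∈ Φ.piece e,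
      |‖fderiv ℝ (ψ e) x‖ - ‖fderiv ℝ (ψ e) y‖| ≤
        L * (⨆ z : Φ.piece e, ‖(fderiv ℝ (ψ e) z).inverse‖)⁻¹ * ‖x - y‖ ^ α
  /-- cone property -/
  cone : ∃ γ l : ℝ, 0 < γ ∧ γ < Real.pi / 2 ∧ 0 < l ∧
    ∀ x ∈ Φ.Y, ∃ u : EuclideanSpace ℝ (Fin d), ‖u‖ = 1 ∧ openCone x u γ l ⊆ interior Φ.Y

end ShiftGenerated

/-! Give each word `w` the weight `R w`, the supremum of the derivative norm of the composition
along `w`. Bounded distortion makes `R` multiplicative up to a constant `K`, and `R` decays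
exponentially in the length. Dimension is then read off from sums of powers of weights in two ways.
If every point of a subshift splits off a non-empty word of a family with `∑ R ^ s ≤ 1`, and stays
in the subshift, iteration gives arbitrarily fine covers and dimension at most `s`
(`dimH_limitSet_le`). Conversely, a closed set of sequences whose limit set has dimension below `t`
is covered by the cylinders of finitely many non-empty words with `∑ R ^ t < 1`
(`exists_finset_cover`). This second fact is a volume argument: by the open set condition few
incomparable words of comparable weight can meet a small set.

Let `t` be below the dimension of the full limit set. Some letter `a` then has a finite set of loops
of equal length with `∑ (R / K) ^ t ≥ 1`; otherwise the long loops at every letter would give covers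
proving a smaller dimension (`exists_isRich`). Division by `K` makes these sums supermultiplicative,
so powers of the set inherit the bound. A high power can be thinned until the sum lies in `[1, 2]`,
and exponential decay then forces `∑ R ^ (t + ε) < 1` (`exists_next`). Repeating this with `ε = 1 /
(k + 1)` gives sets `W k`, each inside a power of its predecessor, that are rich at exponent `t` and
small at exponents decreasing to `t`.

The subshift consists of the sequences whose factors all occur in concatenations of `W k`, for every
`k`. Smallness gives dimension at most `t`. For the lower bound, suppose a finite family with `∑ R ^
t < 1` covers the subshift. A renewal estimate against richness shows that each stage has
arbitrarily long factors beginning with no word of the family (`not_covered`), and compactness turns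
them into an uncovered point.

The pieces need not be convex, so distances are compared with derivatives only at small scales. This
costs a factor `c ^ length` with `c` close to `1`, which is absorbed by an arbitrarily small change
of the exponent of `R`. -/

namespace ShiftGenerated

/-! ### Words, loops, concatenations and their factors. -/

section Words

variable {A : Type*}

/-- Remove the first `n` letters of a sequence. -/
def tail (n : ℕ) (x : ℕ → A) : ℕ → A := fun k => x (n + k)

@[simp] theorem length_firstLetters (x : ℕ → A) (n : ℕ) : (firstLetters x n).length = n := by
  simp [firstLetters]

theorem getElem_firstLetters (x : ℕ → A) (n i : ℕ) (h : i < (firstLetters x n).length) :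
    (firstLetters x n)[i] = x i := by
  simp [firstLetters]

theorem firstLetters_add (x : ℕ → A) (m n : ℕ) :
    firstLetters x (m + n) = firstLetters x m ++ firstLetters (tail m x) n := by
  refine List.ext_getElem (by simp) fun i h1 h2 => ?_
  rw [getElem_firstLetters, List.getElem_append]
  split_ifs with h
  · rw [getElem_firstLetters]
  · rw [getElem_firstLetters]
    simp only [length_firstLetters] at h ⊢
    rw [tail]
    congr 1
    omega

theorem tail_add (x : ℕ → A) (m n : ℕ) : tail (m + n) x = tail n (tail m x) := by
  funext k
  simp [tail, add_assoc]

theorem tail_zero (x : ℕ → A) : tail 0 x = x := by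
  funext k
  simp [tail]

theorem tail_one (x : ℕ → A) : tail 1 x = shift x := by
  funext k
  simp [tail, shift, add_comm]

/-- The word `w` is an initial segment of the sequence `x`. -/
def StartsWith (x : ℕ → A) (w : List A) : Prop := firstLetters x w.length = w

theorem StartsWith.append {x : ℕ → A} {u v : List A} (hu : StartsWith x u)
    (hv : StartsWith (tail u.length x) v) : StartsWith x (u ++ v) := by
  rw [StartsWith, List.length_append, firstLetters_add, hu, hv]

theorem startsWith_firstLetters (x : ℕ → A) (n : ℕ) : StartsWith x (firstLetters x n) := by
  simp [StartsWith]

theorem StartsWith.of_append {x : ℕ → A} {u v : List A} (h : StartsWith x (u ++ v)) :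
    StartsWith x u ∧ StartsWith (tail u.length x) v := by
  rw [StartsWith, List.length_append, firstLetters_add] at h
  exact List.append_inj h (by simp)

/-- A family of words covers a set of sequences if every point is the concatenation of a word of
the family and a point of the set. -/
def Covers (F : Set (List A)) (X : Set (ℕ → A)) : Prop :=
  ∀ x ∈ X, ∃ w ∈ F, StartsWith x w ∧ tail w.length x ∈ X

/-- A weight on words: submultiplicative, supermultiplicative up to the constant `K`, and
exponentially decaying, on the words all of whose pairs of consecutive letters are related. -/
structure IsWeight (r : A → A → Prop) (R : List A → ℝ≥0∞) (K θ : ℝ≥0∞) : Prop where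
  one_le : 1 ≤ K
  ne_top : K ≠ ⊤
  lt_one : θ < 1
  nil : R [] = 1
  ne_zero : ∀ w : List A, w.IsChain r → R w ≠ 0
  le_pow : ∀ w : List A, w.IsChain r → R w ≤ θ ^ w.length
  append_le : ∀ u v : List A, (u ++ v).IsChain r → R (u ++ v) ≤ R u * R v
  le_append : ∀ u v : List A, (u ++ v).IsChain r → R u * R v ≤ K * R (u ++ v)

namespace IsWeight

variable {r : A → A → Prop} {R : List A → ℝ≥0∞} {K θ : ℝ≥0∞}

theorem le_one (h : IsWeight r R K θ) {w : List A} (hw : w.IsChain r) : R w ≤ 1 :=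
  (h.le_pow w hw).trans (pow_le_one₀ (zero_le) h.lt_one.le)

theorem ne_top' (h : IsWeight r R K θ) {w : List A} (hw : w.IsChain r) : R w ≠ ⊤ :=
  ((h.le_one hw).trans_lt ENNReal.one_lt_top).ne

theorem const_ne_zero (h : IsWeight r R K θ) : K ≠ 0 :=
  (zero_lt_one.trans_le h.one_le).ne'

end IsWeight

/-- The word `w` is a loop at the letter `a`. -/
def IsLoop (r : A → A → Prop) (a : A) (w : List A) : Prop :=
  w.IsChain r ∧ w.head? = some a ∧ ∀ x ∈ w.getLast?, r x a

theorem IsLoop.append {r : A → A → Prop} {a : A} {u v : List A} (hu : IsLoop r a u)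
    (hv : IsLoop r a v) : IsLoop r a (u ++ v) := by
  refine ⟨List.isChain_append.2 ⟨hu.1, hv.1, fun x hx y hy => ?_⟩, ?_, fun x hx => ?_⟩
  · rw [hv.2.1] at hy
    obtain rfl : a = y := by simpa using hy
    exact hu.2.2 x hx
  · simp [List.head?_append, hu.2.1]
  · have hne : v ≠ [] := by
      rintro rfl
      simpa using hv.2.1
    rw [List.getLast?_append_of_ne_nil _ hne] at hx
    exact hv.2.2 x hx

/-- The set of `m`-fold concatenations of words of `W`. -/
noncomputable def wordPow (W : Finset (List A)) : ℕ → Finset (List A)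
  | 0 => {[]}
  | m + 1 => by classical exact Finset.image₂ (· ++ ·) W (wordPow W m)

theorem mem_wordPow_succ {W : Finset (List A)} {m : ℕ} {w : List A} :
    w ∈ wordPow W (m + 1) ↔ ∃ u ∈ W, ∃ v ∈ wordPow W m, u ++ v = w := by
  classical
  rw [wordPow, Finset.mem_image₂]

theorem mem_wordPow_zero {W : Finset (List A)} {w : List A} : w ∈ wordPow W 0 ↔ w = [] := by
  rw [wordPow, Finset.mem_singleton]

theorem mem_wordPow_add {W : Finset (List A)} {m n : ℕ} {w : List A} :
    w ∈ wordPow W (m + n) ↔ ∃ u ∈ wordPow W m, ∃ v ∈ wordPow W n, u ++ v = w := by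
  induction m generalizing w with
  | zero => simp [mem_wordPow_zero]
  | succ m ih =>
    rw [add_right_comm, mem_wordPow_succ]
    constructor
    · rintro ⟨u, hu, v, hv, rfl⟩
      obtain ⟨v₁, hv₁, v₂, hv₂, rfl⟩ := ih.1 hv
      exact ⟨u ++ v₁, mem_wordPow_succ.2 ⟨u, hu, v₁, hv₁, rfl⟩, v₂, hv₂, by simp⟩
    · rintro ⟨u, hu, v, hv, rfl⟩
      obtain ⟨u₁, hu₁, u₂, hu₂, rfl⟩ := mem_wordPow_succ.1 hu
      exact ⟨u₁, hu₁, u₂ ++ v, ih.2 ⟨u₂, hu₂, v, hv, rfl⟩, by simp⟩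

theorem wordPow_mul_subset {V W : Finset (List A)} {j : ℕ} (h : V ⊆ wordPow W j) (m : ℕ) :
    wordPow V m ⊆ wordPow W (j * m) := by
  induction m with
  | zero => simp [wordPow]
  | succ m ih =>
    intro w hw
    obtain ⟨u, hu, v, hv, rfl⟩ := mem_wordPow_succ.1 hw
    rw [mul_add, mul_one, add_comm]
    exact mem_wordPow_add.2 ⟨u, h hu, v, ih hv, rfl⟩

theorem length_of_mem_wordPow {W : Finset (List A)} {N : ℕ} (hN : ∀ w ∈ W, w.length = N) {m : ℕ}
    {w : List A} (hw : w ∈ wordPow W m) : w.length = N * m := by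
  induction m generalizing w with
  | zero => simp [mem_wordPow_zero.1 hw]
  | succ m ih =>
    obtain ⟨u, hu, v, hv, rfl⟩ := mem_wordPow_succ.1 hw
    rw [List.length_append, hN u hu, ih hv]
    ring

/-- Equal lengths make the decomposition into blocks unique, so the sum is not merely bounded by the
double sum but equal to it. -/
theorem sum_wordPow_succ {W : Finset (List A)} {N : ℕ} (hN : ∀ w ∈ W, w.length = N) (m : ℕ)
    (f : List A → ℝ≥0∞) :
    ∑ w ∈ wordPow W (m + 1), f w = ∑ u ∈ W, ∑ v ∈ wordPow W m, f (u ++ v) := by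
  classical
  rw [wordPow, ← Finset.image_uncurry_product, Finset.sum_image, Finset.sum_product]
  · rfl
  · rintro ⟨u, v⟩ h ⟨u', v'⟩ h' heq
    simp only [Finset.coe_product, Set.mem_prod, Finset.mem_coe] at h h'
    obtain ⟨h1, h2⟩ := List.append_inj heq (by rw [hN u h.1, hN u' h'.1])
    exact Prod.ext h1 h2

theorem IsLoop.of_mem_wordPow {r : A → A → Prop} {a : A} {W : Finset (List A)}
    (hW : ∀ w ∈ W, IsLoop r a w) {m : ℕ} {w : List A} (hw : w ∈ wordPow W (m + 1)) :
    IsLoop r a w := by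
  induction m generalizing w with
  | zero =>
    obtain ⟨u, hu, v, hv, rfl⟩ := mem_wordPow_succ.1 hw
    rw [mem_wordPow_zero.1 hv, List.append_nil]
    exact hW u hu
  | succ m ih =>
    obtain ⟨u, hu, v, hv, rfl⟩ := mem_wordPow_succ.1 hw
    exact (hW u hu).append (ih hv)

theorem isChain_of_mem_wordPow {r : A → A → Prop} {a : A} {W : Finset (List A)}
    (hW : ∀ w ∈ W, IsLoop r a w) {m : ℕ} {w : List A} (hw : w ∈ wordPow W m) : w.IsChain r := by
  cases m with
  | zero => simp [mem_wordPow_zero.1 hw]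
  | succ m => exact (IsLoop.of_mem_wordPow hW hw).1

/-- A word of a power of `W`, cut at a place beyond `m` blocks, begins with `m` full blocks. -/
theorem exists_prefix_mem_wordPow {W : Finset (List A)} {N : ℕ} (hN : ∀ w ∈ W, w.length = N)
    (hN0 : 0 < N) {j m : ℕ} {p q : List A} (h : p ++ q ∈ wordPow W j) (hp : N * m ≤ p.length) :
    ∃ v ∈ wordPow W m, v <+: p := by
  have hl := length_of_mem_wordPow hN h
  have hjm : m ≤ j := by
    rw [List.length_append] at hl
    exact Nat.le_of_mul_le_mul_left (by omega) hN0
  obtain ⟨k, rfl⟩ := Nat.exists_eq_add_of_le hjm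
  obtain ⟨u, hu, v, hv, huv⟩ := mem_wordPow_add.1 h
  refine ⟨u, hu, List.prefix_of_prefix_length_le (l₃ := p ++ q) ⟨v, huv⟩ ⟨q, rfl⟩ ?_⟩
  rwa [length_of_mem_wordPow hN hu]

/-- The factors of concatenations of words of `W`. -/
def factors (W : Finset (List A)) : Set (List A) := {u | ∃ m, ∃ v ∈ wordPow W m, u <:+: v}

/-- Makes the languages of the successive stages of the construction decreasing. -/
theorem factors_antitone {V W : Finset (List A)} {j : ℕ} (h : V ⊆ wordPow W j) :
    factors V ⊆ factors W := fun _ ⟨m, v, hv, hu⟩ => ⟨j * m, v, wordPow_mul_subset h m hv, hu⟩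

theorem factors_of_infix {W : Finset (List A)} {u v : List A} (hv : v ∈ factors W)
    (h : u <:+: v) : u ∈ factors W :=
  let ⟨m, w, hw, hvw⟩ := hv
  ⟨m, w, hw, h.trans hvw⟩

theorem isChain_of_mem_factors {r : A → A → Prop} {a : A} {W : Finset (List A)}
    (hW : ∀ w ∈ W, IsLoop r a w) {u : List A} (hu : u ∈ factors W) : u.IsChain r :=
  let ⟨_, _, hv, huv⟩ := hu
  (isChain_of_mem_wordPow hW hv).infix huv

theorem mem_factors_of_mem_wordPow {W : Finset (List A)} {m : ℕ} {w : List A}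
    (hw : w ∈ wordPow W m) : w ∈ factors W := ⟨m, w, hw, List.infix_rfl⟩

/-- A long factor begins with a short word followed by `m` full blocks. -/
theorem exists_prefix_of_mem_factors {W : Finset (List A)} {N : ℕ} (hN0 : 0 < N)
    (hN : ∀ w ∈ W, w.length = N) {m : ℕ} {w : List A} (hw : w ∈ factors W)
    (hl : N * (m + 1) ≤ w.length) :
    ∃ u v, u.length ≤ N ∧ v ∈ wordPow W m ∧ u ++ v <+: w := by
  obtain ⟨j, z, hz, p, q, rfl⟩ := hw
  induction j generalizing p with
  | zero =>
    have := mem_wordPow_zero.1 hz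
    simp at this
    simp [this.2.1] at hl
    omega
  | succ j ih =>
    obtain ⟨u, hu, v, hv, huv⟩ := mem_wordPow_succ.1 hz
    rw [List.append_assoc, List.append_eq_append_iff] at huv
    rcases huv with ⟨p', rfl, rfl⟩ | ⟨u', rfl, huv⟩
    -- The first block ends before the factor begins, so it can be discarded.
    · exact ih p' (by simpa using hv)
    · rw [List.append_eq_append_iff] at huv
      have hu' : u'.length ≤ N := by
        have := hN _ hu
        rw [List.length_append] at this
        omega
      -- Either the whole factor lies inside one block, so its length forces `m = 0`, or it starts
      -- with the end `u'` of a block, and what remains has length at least `N * m`.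
      rcases huv with ⟨c, rfl, rfl⟩ | ⟨c, rfl, rfl⟩
      · rw [List.length_append] at hu'
        have hm : m = 0 := by
          by_contra h
          have : N * 2 ≤ N * (m + 1) := Nat.mul_le_mul_left N (by omega)
          omega
        subst hm
        exact ⟨w, [], by omega, mem_wordPow_zero.2 rfl, by simp⟩
      · obtain ⟨v', hv', h⟩ := exists_prefix_mem_wordPow hN hN0 (p := c) hv (m := m) (by
          rw [List.length_append, mul_add, mul_one] at hl
          omega)
        exact ⟨u', v', hu', hv', by simpa using h⟩

end Words

/-! ### Sums of powers of weights and rich sets of loops. -/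

section WeightSums

variable {A : Type*} {r : A → A → Prop} {R : List A → ℝ≥0∞} {K θ : ℝ≥0∞}

theorem IsWeight.tsum_append_le (h : IsWeight r R K θ) {F U V : Set (List A)}
    (hF : ∀ w ∈ F, w.IsChain r ∧ ∃ u ∈ U, ∃ v ∈ V, u ++ v = w) {s : ℝ} (hs : 0 ≤ s) :
    ∑' w : F, R w ^ s ≤ (∑' u : U, R u ^ s) * ∑' v : V, R v ^ s := by
  choose hc u hu v hv huv using hF
  -- A word is recovered from its two halves, so the sum over `F` is dominated by the sum over the
  -- product, whatever the lengths.
  let g : F → U × V := fun w => (⟨u w w.2, hu w w.2⟩, ⟨v w w.2, hv w w.2⟩)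
  have hg : Function.Injective g := by
    intro w w' hww
    simp only [g, Prod.mk.injEq, Subtype.mk.injEq] at hww
    exact Subtype.ext (by rw [← huv w w.2, ← huv w' w'.2, hww.1, hww.2])
  calc ∑' w : F, R w ^ s ≤ ∑' w : F, R (g w).1 ^ s * R (g w).2 ^ s := by
        refine ENNReal.tsum_le_tsum fun w => ?_
        rw [← ENNReal.mul_rpow_of_nonneg _ _ hs]
        refine ENNReal.rpow_le_rpow ?_ hs
        have := h.append_le (u w w.2) (v w w.2) (by rw [huv]; exact hc w w.2)
        rwa [huv] at this
    _ ≤ ∑' p : U × V, R p.1 ^ s * R p.2 ^ s :=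
        ENNReal.tsum_comp_le_tsum_of_injective hg fun p : U × V => R p.1 ^ s * R p.2 ^ s
    _ = _ := by
        rw [ENNReal.tsum_prod (f := fun (u : U) (v : V) => R u ^ s * R v ^ s)]
        simp_rw [ENNReal.tsum_mul_left]
        rw [ENNReal.tsum_mul_right]

theorem IsWeight.sum_wordPow_le (h : IsWeight r R K θ) {W : Finset (List A)} {N : ℕ}
    (hN : ∀ w ∈ W, w.length = N) {a : A} (hW : ∀ w ∈ W, IsLoop r a w) {s : ℝ} (hs : 0 ≤ s)
    (m : ℕ) : ∑ w ∈ wordPow W m, R w ^ s ≤ (∑ w ∈ W, R w ^ s) ^ m := by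
  induction m with
  | zero => simp [wordPow, h.nil]
  | succ m ih =>
    rw [sum_wordPow_succ hN, pow_succ', Finset.sum_mul]
    refine Finset.sum_le_sum fun u hu => ?_
    refine le_trans ?_ (mul_le_mul_right ih _)
    rw [Finset.mul_sum]
    refine Finset.sum_le_sum fun v hv => ?_
    rw [← ENNReal.mul_rpow_of_nonneg _ _ hs]
    refine ENNReal.rpow_le_rpow (h.append_le u v ?_) hs
    exact isChain_of_mem_wordPow hW (mem_wordPow_succ.2 ⟨u, hu, v, hv, rfl⟩)

/-- Supermultiplicativity of the normalized sums. -/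
theorem IsWeight.one_le_sum_wordPow (h : IsWeight r R K θ) {W : Finset (List A)} {N : ℕ}
    (hN : ∀ w ∈ W, w.length = N) {a : A} (hW : ∀ w ∈ W, IsLoop r a w) {t : ℝ} (ht : 0 ≤ t)
    (hsum : 1 ≤ ∑ w ∈ W, (R w / K) ^ t) (m : ℕ) :
    1 ≤ ∑ w ∈ wordPow W (m + 1), (R w / K) ^ t := by
  induction m with
  | zero =>
    rw [sum_wordPow_succ hN]
    simpa [wordPow] using hsum
  | succ m ih =>
    rw [sum_wordPow_succ hN]
    calc (1 : ℝ≥0∞) = 1 * 1 := (one_mul 1).symm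
      _ ≤ (∑ w ∈ W, (R w / K) ^ t) * ∑ w ∈ wordPow W (m + 1), (R w / K) ^ t :=
          mul_le_mul' hsum ih
      _ ≤ _ := by
          rw [Finset.sum_mul]
          refine Finset.sum_le_sum fun u hu => ?_
          rw [Finset.mul_sum]
          refine Finset.sum_le_sum fun v hv => ?_
          rw [← ENNReal.mul_rpow_of_nonneg _ _ ht]
          refine ENNReal.rpow_le_rpow ?_ ht
          have := h.le_append u v
            (isChain_of_mem_wordPow hW (mem_wordPow_succ.2 ⟨u, hu, v, hv, rfl⟩))
          rw [div_eq_mul_inv, div_eq_mul_inv, div_eq_mul_inv, mul_mul_mul_comm, ← mul_assoc]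
          refine mul_le_mul_left (ENNReal.div_le_of_le_mul ?_) _
          rwa [mul_comm (R (u ++ v))]

/-- Terms are at most `1`, so adding them one by one cannot jump over `[1, 2]`. -/
theorem exists_subset_sum_mem_Icc {ι : Type*} (V : Finset ι) (f : ι → ℝ≥0∞)
    (hf : ∀ i ∈ V, f i ≤ 1) (hV : 1 ≤ ∑ i ∈ V, f i) :
    ∃ U ⊆ V, 1 ≤ ∑ i ∈ U, f i ∧ ∑ i ∈ U, f i ≤ 2 := by
  classical
  induction V using Finset.induction_on with
  | empty => simp at hV
  | insert i V hi ih =>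
    by_cases h : 1 ≤ ∑ i ∈ V, f i
    · obtain ⟨U, hU, h1⟩ := ih (fun j hj => hf j (Finset.mem_insert_of_mem hj)) h
      exact ⟨U, hU.trans (Finset.subset_insert _ _), h1⟩
    · refine ⟨_, subset_rfl, hV, ?_⟩
      rw [Finset.sum_insert hi, ← one_add_one_eq_two]
      exact add_le_add (hf i (Finset.mem_insert_self _ _)) (not_le.1 h).le

/-- A finite set of loops of equal length at `a`, rich enough to carry dimension at least `t`. -/
structure IsRich (r : A → A → Prop) (R : List A → ℝ≥0∞) (K : ℝ≥0∞) (a : A) (t : ℝ)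
    (W : Finset (List A)) : Prop where
  exists_length : ∃ N, 0 < N ∧ ∀ w ∈ W, w.length = N
  isLoop : ∀ w ∈ W, IsLoop r a w
  one_le_sum : 1 ≤ ∑ w ∈ W, (R w / K) ^ t

theorem exists_pow_mul_le_one {q C : ℝ≥0∞} (hq : q < 1) (hC : C ≠ ⊤) :
    ∃ n : ℕ, ∀ m ≥ n, C * q ^ m < 1 := by
  have := ENNReal.Tendsto.const_mul (ENNReal.tendsto_pow_atTop_nhds_zero_of_lt_one hq)
    (Or.inr hC)
  rw [mul_zero] at this
  exact Filter.eventually_atTop.1 (this.eventually_lt_const zero_lt_one)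

/-- Thin a power of `W` to `V` with normalized sum in `[1, 2]`. Then `∑ R ^ (t + ε)` is at most `2 *
K ^ t` times the largest `R ^ ε`, which is small for long words. -/
theorem IsRich.exists_next (h : IsWeight r R K θ) {a : A} {t : ℝ} (ht : 0 ≤ t)
    {W : Finset (List A)} (hW : IsRich r R K a t W) {ε : ℝ} (hε : 0 < ε) :
    ∃ V, IsRich r R K a t V ∧ (∃ j, V ⊆ wordPow W j) ∧ ∑ w ∈ V, R w ^ (t + ε) < 1 := by
  obtain ⟨N, hN0, hN⟩ := hW.exists_length
  have hθ : θ ^ ε < 1 := ENNReal.rpow_lt_one h.lt_one hε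
  have hK : 2 * K ^ t ≠ ⊤ := ENNReal.mul_ne_top (by simp) (ENNReal.rpow_ne_top_of_nonneg ht h.ne_top)
  obtain ⟨m, hm⟩ := exists_pow_mul_le_one hθ hK
  have hc : ∀ w ∈ wordPow W (m + 1), IsLoop r a w := fun w => IsLoop.of_mem_wordPow hW.isLoop
  obtain ⟨V, hVW, h1, h2⟩ := exists_subset_sum_mem_Icc (wordPow W (m + 1))
    (fun w => (R w / K) ^ t) (fun w hw => ENNReal.rpow_le_one (ENNReal.div_le_of_le_mul
      (by rw [one_mul]; exact (h.le_one (hc w hw).1).trans h.one_le)) ht)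
    (h.one_le_sum_wordPow hN hW.isLoop ht hW.one_le_sum m)
  have hVN : ∀ w ∈ V, w.length = N * (m + 1) := fun w hw => length_of_mem_wordPow hN (hVW hw)
  refine ⟨V, ⟨⟨N * (m + 1), by positivity, hVN⟩, fun w hw => hc w (hVW hw), h1⟩,
    ⟨m + 1, hVW⟩, ?_⟩
  calc ∑ w ∈ V, R w ^ (t + ε)
      ≤ ∑ w ∈ V, (R w / K) ^ t * (K ^ t * (θ ^ ε) ^ (N * (m + 1))) := by
        refine Finset.sum_le_sum fun w hw => ?_
        have hwc := (hc w (hVW hw)).1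
        rw [ENNReal.rpow_add _ _ (h.ne_zero w hwc) (h.ne_top' hwc), ← mul_assoc,
          ← ENNReal.mul_rpow_of_nonneg _ _ ht, ENNReal.div_mul_cancel h.const_ne_zero h.ne_top]
        refine mul_le_mul_right ?_ _
        rw [← ENNReal.rpow_natCast, ← ENNReal.rpow_mul, mul_comm ε, ENNReal.rpow_mul,
          ENNReal.rpow_natCast, ← hVN w hw]
        exact ENNReal.rpow_le_rpow (h.le_pow w hwc) hε.le
    _ ≤ 2 * (K ^ t * (θ ^ ε) ^ (N * (m + 1))) := by
        rw [← Finset.sum_mul]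
        exact mul_le_mul_left h2 _
    _ < 1 := by
        rw [← mul_assoc]
        exact hm _ (by nlinarith)

/-- The richness exponent stays at `t` throughout, while the exponent of smallness decreases to `t`.
-/
theorem IsRich.exists_seq (h : IsWeight r R K θ) {a : A} {t : ℝ} (ht : 0 ≤ t)
    {W₀ : Finset (List A)} (hW₀ : IsRich r R K a t W₀) :
    ∃ W : ℕ → Finset (List A), (∀ k, IsRich r R K a t (W k)) ∧
      (∀ k, ∃ j, W (k + 1) ⊆ wordPow (W k) j) ∧
      ∀ k : ℕ, ∑ w ∈ W (k + 1), R w ^ (t + 1 / (k + 1 : ℝ)) < 1 := by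
  choose! V hV hj hs using fun (W : Finset (List A)) (k : ℕ) (hW : IsRich r R K a t W) =>
    hW.exists_next h ht (ε := 1 / (k + 1 : ℝ)) (by positivity)
  let W : ℕ → Finset (List A) := fun n => Nat.rec W₀ (fun k U => V U k) n
  have hW : ∀ k, IsRich r R K a t (W k) := fun k => by
    induction k with
    | zero => exact hW₀
    | succ k ih => exact hV _ k ih
  exact ⟨W, hW, fun k => hj _ k (hW k), fun k => hs _ k (hW k)⟩

theorem IsWeight.tsum_rpow_ne_top [Finite A] (h : IsWeight r R K θ) {s : ℝ} (hs : 0 ≤ s)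
    {L : Set (List A)} (hL : ∀ w ∈ L, w.IsChain r) {N : ℕ} (hN : ∀ w ∈ L, w.length ≤ N) :
    ∑' w : L, R w ^ s ≠ ⊤ := by
  have : Finite L := Set.Finite.subset (List.finite_length_le A N) hN
  have := Fintype.ofFinite L
  rw [tsum_fintype]
  refine (ENNReal.sum_lt_top.2 fun w _ => ?_).ne
  exact (ENNReal.rpow_le_one (h.le_one (hL w w.2)) hs).trans_lt ENNReal.one_lt_top

/-- If every long word of a factorial language begins with a word of `F`, and the weights of `F`
sum to less than `1`, then the weights of the words of length `M` sum to less than `1` for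
large `M`. -/
theorem IsWeight.exists_tsum_length_lt_one [Finite A] (h : IsWeight r R K θ) {L : Set (List A)}
    (hL : ∀ w ∈ L, w.IsChain r) (hLf : ∀ u v : List A, u ++ v ∈ L → v ∈ L) {t : ℝ} (ht : 0 ≤ t)
    {F : Finset (List A)} (hF0 : ∀ f ∈ F, f ≠ []) (hF : ∑ f ∈ F, R f ^ t < 1) {n : ℕ}
    (hn : ∀ w ∈ L, n ≤ w.length → ∃ f ∈ F, f <+: w) :
    ∃ M₀, ∀ M ≥ M₀, ∑' w : {w ∈ L | w.length = M}, R w ^ t < 1 := by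
  set a : ℕ → ℝ≥0∞ := fun M => ∑' w : {w ∈ L | w.length = M}, R w ^ t with ha
  set q := ∑ f ∈ F, R f ^ t with hq
  obtain ⟨n₀, hn₀, hn₁, hnF⟩ : ∃ n₀, 0 < n₀ ∧ n ≤ n₀ ∧ ∀ f ∈ F, f.length ≤ n₀ :=
    ⟨n + 1 + F.sup List.length, by omega, by omega, fun f hf =>
      (Finset.le_sup (f := List.length) hf).trans (by omega)⟩
  -- Renewal inequality: remove from a word of length `M` its initial word in `F`; the rest is again
  -- in `L`.
  have hrec : ∀ M ≥ n₀, a M ≤ ∑ f ∈ F, R f ^ t * a (M - f.length) := by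
    intro M hM
    have hsub : {w ∈ L | w.length = M} ⊆
        ⋃ f ∈ F, {w ∈ L | w.length = M ∧ f <+: w} := by
      rintro w ⟨hw, hwM⟩
      obtain ⟨f, hf, hfw⟩ := hn w hw (by omega)
      exact mem_biUnion hf ⟨hw, hwM, hfw⟩
    refine (ENNReal.tsum_mono_subtype (fun w => R w ^ t) hsub).trans ?_
    refine (ENNReal.tsum_biUnion_le (fun w => R w ^ t) F _).trans ?_
    refine Finset.sum_le_sum fun f hf => ?_
    refine (h.tsum_append_le (U := {f}) (V := {w ∈ L | w.length = M - f.length}) ?_ ht).trans ?_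
    · rintro w ⟨hw, hwM, v, rfl⟩
      refine ⟨hL _ hw, f, rfl, v, ⟨hLf _ _ hw, ?_⟩, rfl⟩
      rw [List.length_append] at hwM
      omega
    · rw [tsum_singleton f fun w => R w ^ t]
  set C := ∑ i ∈ Finset.range n₀, a i with hC
  have hCt : C ≠ ⊤ := by
    refine (ENNReal.sum_lt_top.2 fun i _ => lt_top_iff_ne_top.2 ?_).ne
    exact h.tsum_rpow_ne_top ht (N := i) (fun w hw => hL w hw.1) fun w hw => hw.2.le
  -- Each removal gains a factor `q` and shortens by at least one and at most `n₀` letters, hence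
  -- geometric decay in `M / n₀`.
  have hbound : ∀ M, a M ≤ C * q ^ (M / n₀) := by
    intro M
    induction M using Nat.strong_induction_on with
    | _ M ih =>
      rcases Nat.lt_or_ge M n₀ with hM | hM
      · rw [Nat.div_eq_of_lt hM, pow_zero, mul_one]
        exact Finset.single_le_sum (f := a) (fun _ _ => zero_le) (Finset.mem_range.2 hM)
      · refine (hrec M hM).trans ?_
        have hdiv : M / n₀ = (M - n₀) / n₀ + 1 := by
          rw [← Nat.div_eq_sub_div hn₀ hM]
        rw [hdiv, pow_succ, ← mul_assoc, mul_comm _ q, hq, Finset.sum_mul, ← hq]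
        refine Finset.sum_le_sum fun f hf => mul_le_mul_right ?_ _
        have hf0 : 0 < f.length := List.length_pos_iff.2 (hF0 f hf)
        refine (ih _ (by omega)).trans (mul_le_mul_right ?_ _)
        refine pow_le_pow_of_le_one (zero_le) hF.le (Nat.div_le_div_right ?_)
        have := hnF f hf
        omega
  obtain ⟨k, hk⟩ := exists_pow_mul_le_one hF hCt
  refine ⟨n₀ * k, fun M hM => (hbound M).trans_lt (hk _ ?_)⟩
  rw [ge_iff_le, Nat.le_div_iff_mul_le hn₀]
  linarith

/-- The language of the concatenations of a rich set cannot be covered by a family of words of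
small total weight. -/
theorem IsRich.not_covered [Finite A] (h : IsWeight r R K θ) {a : A} {t : ℝ} (ht : 0 ≤ t)
    {W : Finset (List A)} (hW : IsRich r R K a t W) {F : Finset (List A)}
    (hF0 : ∀ f ∈ F, f ≠ []) (hF : ∑ f ∈ F, R f ^ t < 1) (n : ℕ) :
    ∃ w ∈ factors W, n ≤ w.length ∧ ∀ f ∈ F, ¬ f <+: w := by
  by_contra! hn
  obtain ⟨M, hM⟩ := h.exists_tsum_length_lt_one (L := factors W)
    (fun w => isChain_of_mem_factors hW.isLoop)
    (fun u v huv => factors_of_infix huv (List.suffix_append u v).isInfix) ht hF0 hF hn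
  obtain ⟨N, hN0, hN⟩ := hW.exists_length
  -- At a large multiple of the block length, concatenations of blocks alone already have total
  -- weight at least `1`.
  refine (hM (N * (M + 1)) (by nlinarith)).not_ge ?_
  calc (1 : ℝ≥0∞) ≤ ∑ w ∈ wordPow W (M + 1), (R w / K) ^ t :=
        h.one_le_sum_wordPow hN hW.isLoop ht hW.one_le_sum M
    _ ≤ ∑ w ∈ wordPow W (M + 1), R w ^ t := by
        refine Finset.sum_le_sum fun w _ => ENNReal.rpow_le_rpow ?_ ht
        exact ENNReal.div_le_of_le_mul (le_mul_of_one_le_right' h.one_le)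
    _ = ∑' w : (wordPow W (M + 1) : Set (List A)), R w ^ t :=
        (Finset.tsum_subtype' _ fun w => R w ^ t).symm
    _ ≤ _ := ENNReal.tsum_mono_subtype (fun w => R w ^ t)
        (t := {w ∈ factors W | w.length = N * (M + 1)}) fun w hw =>
        ⟨mem_factors_of_mem_wordPow hw, length_of_mem_wordPow hN hw⟩

/-- Raising the exponent from `t` to `t'` gains `θ ^ (n * (t' - t))` on words of length `n`, so
uniformly bounded sums become the tail of a geometric series. -/
theorem IsWeight.exists_tsum_loops_le_one (h : IsWeight r R K θ) {a : A} {t t' : ℝ}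
    (htt : t < t') {B : ℝ≥0∞} (hB : B ≠ ⊤)
    (H : ∀ n, ∑' w : {w | IsLoop r a w ∧ w.length = n}, R w ^ t ≤ B) :
    ∃ n₀, 0 < n₀ ∧ ∑' w : {w | IsLoop r a w ∧ n₀ ≤ w.length}, R w ^ t' ≤ 1 := by
  set q := θ ^ (t' - t) with hq
  have hq1 : q < 1 := ENNReal.rpow_lt_one h.lt_one (sub_pos.2 htt)
  have hC : B * (1 - q)⁻¹ ≠ ⊤ :=
    ENNReal.mul_ne_top hB (ENNReal.inv_ne_top.2 (tsub_pos_of_lt hq1).ne')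
  obtain ⟨n, hn⟩ := exists_pow_mul_le_one hq1 hC
  refine ⟨n + 1, by omega, ?_⟩
  have hsub : {w | IsLoop r a w ∧ n + 1 ≤ w.length} ⊆
      ⋃ k : ℕ, {w | IsLoop r a w ∧ w.length = n + 1 + k} := by
    rintro w ⟨hw, hl⟩
    exact mem_iUnion.2 ⟨w.length - (n + 1), hw, by omega⟩
  refine (ENNReal.tsum_mono_subtype (fun w => R w ^ t') hsub).trans ?_
  refine (ENNReal.tsum_iUnion_le_tsum (fun w => R w ^ t') _).trans ?_
  calc ∑' (k : ℕ) (w : {w | IsLoop r a w ∧ w.length = n + 1 + k}), R w ^ t'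
      ≤ ∑' k : ℕ, B * q ^ (n + 1) * q ^ k := by
        refine ENNReal.tsum_le_tsum fun k => ?_
        rw [mul_assoc, ← pow_add, mul_comm]
        refine le_trans ?_ (mul_le_mul_right (H (n + 1 + k)) _)
        rw [← ENNReal.tsum_mul_left]
        refine ENNReal.tsum_le_tsum fun w => ?_
        have hw := w.2.1.1
        rw [show t' = (t' - t) + t by ring, ENNReal.rpow_add _ _ (h.ne_zero _ hw) (h.ne_top' hw)]
        refine mul_le_mul_left ?_ _
        rw [hq, ← ENNReal.rpow_natCast, ← ENNReal.rpow_mul, mul_comm (t' - t), ENNReal.rpow_mul,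
          ENNReal.rpow_natCast]
        refine ENNReal.rpow_le_rpow ((h.le_pow _ hw).trans_eq ?_) (sub_pos.2 htt).le
        rw [w.2.2]
    _ = B * (1 - q)⁻¹ * q ^ (n + 1) := by
        rw [ENNReal.tsum_mul_left, ENNReal.tsum_geometric]
        ring
    _ ≤ 1 := (hn _ (by omega)).le

theorem IsRich.of_lt_tsum [Finite A] (h : IsWeight r R K θ) {a : A} {t : ℝ} (ht : 0 ≤ t) {n : ℕ}
    (hn : K ^ t < ∑' w : {w | IsLoop r a w ∧ w.length = n}, R w ^ t) :
    ∃ W, IsRich r R K a t W := by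
  have hfin : {w | IsLoop r a w ∧ w.length = n}.Finite :=
    (List.finite_length_eq A n).subset fun w hw => hw.2
  refine ⟨hfin.toFinset, ⟨n, ?_, fun w hw => (hfin.mem_toFinset.1 hw).2⟩,
    fun w hw => (hfin.mem_toFinset.1 hw).1, ?_⟩
  · rcases Nat.eq_zero_or_pos n with rfl | h0
    · have : {w : List A | IsLoop r a w ∧ w.length = 0} = ∅ := by
        ext w
        simp only [mem_ofPred_eq, mem_empty_iff_false, iff_false, not_and]
        rintro hw hw0
        rw [List.eq_nil_of_length_eq_zero hw0] at hw
        simpa using hw.2.1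
      rw [this] at hn
      simp at hn
    · exact h0
  · have hK0 : K ^ t ≠ 0 := by simp [h.const_ne_zero, ENNReal.rpow_eq_zero_iff, h.ne_top]
    have hKt : K ^ t ≠ ⊤ := ENNReal.rpow_ne_top_of_nonneg ht h.ne_top
    have hset : ∑' w : {w | IsLoop r a w ∧ w.length = n}, R w ^ t
        = ∑ w ∈ hfin.toFinset, R w ^ t := by
      rw [← Finset.tsum_subtype' hfin.toFinset fun w => R w ^ t, hfin.coe_toFinset]
    rw [hset] at hn
    simp_rw [ENNReal.div_rpow_of_nonneg _ _ ht, div_eq_mul_inv]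
    rw [← Finset.sum_mul, ← div_eq_mul_inv, ENNReal.le_div_iff_mul_le (Or.inl hK0) (Or.inl hKt),
      one_mul]
    exact hn.le

end WeightSums

/-! ### Subshifts defined by languages, and compactness. -/

section Shifts

variable {A : Type*}

/-- The sequences all of whose factors belong to `L`. -/
def factorShift (L : Set (List A)) : Set (ℕ → A) := {x | ∀ i n, firstLetters (tail i x) n ∈ L}

theorem tail_mem_factorShift {L : Set (List A)} {x : ℕ → A} (hx : x ∈ factorShift L) (n : ℕ) :
    tail n x ∈ factorShift L := fun i m => by
  rw [← tail_add]
  exact hx _ _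

theorem factorShift_mono {L M : Set (List A)} (h : L ⊆ M) : factorShift L ⊆ factorShift M :=
  fun _ hx i n => h (hx i n)

theorem isClosed_setOf_firstLetters_mem [TopologicalSpace A] [DiscreteTopology A]
    (P : Set (List A)) (i n : ℕ) : IsClosed {x : ℕ → A | firstLetters (tail i x) n ∈ P} := by
  have : {x : ℕ → A | firstLetters (tail i x) n ∈ P} =
      (fun (x : ℕ → A) (j : Fin n) => x (i + j)) ⁻¹' {g | List.ofFn g ∈ P} := rfl
  rw [this]
  exact (isClosed_discrete _).preimage (by fun_prop)

theorem isSubshift_factorShift [TopologicalSpace A] [DiscreteTopology A] (L : Set (List A)) :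
    IsSubshift (factorShift L) := by
  refine ⟨?_, fun x hx => by rw [← tail_one]; exact tail_mem_factorShift hx 1⟩
  simp only [factorShift, ofPred_forall]
  exact isClosed_iInter fun i => isClosed_iInter fun n => isClosed_setOf_firstLetters_mem L i n

theorem firstLetters_tail_infix (x : ℕ → A) {i n k : ℕ} (h : i + n ≤ k) :
    firstLetters (tail i x) n <:+: firstLetters x k := by
  obtain ⟨j, rfl⟩ := Nat.exists_eq_add_of_le h
  exact ⟨firstLetters x i, firstLetters (tail (i + n) x) j, by
    rw [firstLetters_add, firstLetters_add]⟩

theorem firstLetters_prefix (x : ℕ → A) {n k : ℕ} (h : n ≤ k) :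
    firstLetters x n <+: firstLetters x k := by
  obtain ⟨j, rfl⟩ := Nat.exists_eq_add_of_le h
  exact ⟨_, (firstLetters_add x n j).symm⟩

/-- Compactness: arbitrarily long words of a decreasing sequence of factorial languages that do
not begin with a word of `F` have a limit. -/
theorem exists_mem_factorShift_iInter [Finite A] [TopologicalSpace A] [DiscreteTopology A]
    {L : ℕ → Set (List A)} (hanti : Antitone L)
    (hL : ∀ k, ∀ u v : List A, v ∈ L k → u <:+: v → u ∈ L k) (F : Set (List A))
    (h : ∀ k, ∃ w ∈ L k, k ≤ w.length ∧ ∀ f ∈ F, ¬ f <+: w) :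
    ∃ x ∈ factorShift (⋂ k, L k), ∀ f ∈ F, ¬ StartsWith x f := by
  let P : ℕ → Set (List A) := fun k => {u ∈ L k | ∀ f ∈ F, ¬ f <+: u}
  let C : ℕ → Set (ℕ → A) := fun k => {x | firstLetters (tail 0 x) k ∈ P k}
  have hclosed : ∀ k, IsClosed (C k) := fun k => isClosed_setOf_firstLetters_mem _ _ _
  obtain ⟨x, hx⟩ : (⋂ k, C k).Nonempty := by
    refine IsCompact.nonempty_iInter_of_sequence_nonempty_isCompact_isClosed C ?_ ?_
      (hclosed 0).isCompact hclosed
    · rintro k x ⟨hx, hF⟩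
      have hp := firstLetters_prefix (tail 0 x) (Nat.le_succ k)
      exact ⟨hanti (Nat.le_succ k) (hL _ _ _ hx hp.isInfix), fun f hf hfx => hF f hf (hfx.trans hp)⟩
    · intro k
      -- Index `k + 1` ensures that `w` is non-empty, so its head can pad it to a sequence. Only the
      -- first `k` letters matter, so the padding has no effect.
      obtain ⟨w, hw, hk, hF⟩ := h (k + 1)
      have hw0 : w ≠ [] := by
        rintro rfl
        simp at hk
      let x : ℕ → A := fun i => w.getD i (w.head hw0)
      have hxw : firstLetters (tail 0 x) k = w.take k := by
        refine List.ext_getElem (by simp; omega) fun i h1 h2 => ?_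
        rw [getElem_firstLetters, List.getElem_take, tail, zero_add]
        exact List.getD_eq_getElem _ _ _
      refine ⟨x, ?_, fun f hf hfx => hF f hf ?_⟩
      · rw [hxw]
        exact hanti (Nat.le_succ k) (hL _ _ _ hw (List.take_prefix k w).isInfix)
      · rw [hxw] at hfx
        exact hfx.trans (List.take_prefix k w)
  rw [mem_iInter] at hx
  simp only [C, tail_zero] at hx
  refine ⟨x, fun i n => mem_iInter.2 fun k => ?_, fun f hf hfx => ?_⟩
  · refine hanti (le_max_left k (i + n)) (hL _ _ _ (hx (max k (i + n))).1 ?_)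
    exact firstLetters_tail_infix x (le_max_right _ _)
  · exact (hx f.length).2 f hf (by rw [hfx])

variable {r : A → A → Prop} {R : List A → ℝ≥0∞} {K θ : ℝ≥0∞}

/-- A point of `X` begins with a piece of a block followed by `m + 1` full blocks. The incomplete
pieces contribute a finite constant, which the power `m + 1` of a sum below `1` outweighs. -/
theorem IsRich.exists_covers [Finite A] (h : IsWeight r R K θ) {a : A} {t : ℝ}
    {W : Finset (List A)} (hW : IsRich r R K a t W) {s : ℝ} (hs : 0 ≤ s)
    (hsum : ∑ w ∈ W, R w ^ s < 1) {X : Set (ℕ → A)} (hX : X ⊆ factorShift (factors W))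
    (hXt : ∀ x ∈ X, ∀ n, tail n x ∈ X) :
    ∃ F : Set (List A), (∀ w ∈ F, w ≠ []) ∧ Covers F X ∧ ∑' w : F, R w ^ s ≤ 1 := by
  obtain ⟨N, hN0, hN⟩ := hW.exists_length
  set U : Set (List A) := {u | u.IsChain r ∧ u.length ≤ N} with hU
  have hUt : ∑' u : U, R u ^ s ≠ ⊤ := h.tsum_rpow_ne_top hs (fun u hu => hu.1) fun u hu => hu.2
  obtain ⟨m, hm⟩ := exists_pow_mul_le_one hsum hUt
  refine ⟨{w | w.IsChain r ∧ ∃ u ∈ U, ∃ v ∈ (wordPow W (m + 1) : Set (List A)), u ++ v = w},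
    ?_, ?_, ?_⟩
  · rintro w ⟨-, u, -, v, hv, rfl⟩ h0
    have := length_of_mem_wordPow hN hv
    rw [(List.append_eq_nil_iff.1 h0).2] at this
    have : 0 < N * (m + 1) := by positivity
    simp_all
  · intro x hx
    have hxw := hX hx 0 (N * (m + 1 + 1))
    rw [tail_zero] at hxw
    obtain ⟨u, v, hu, hv, huv⟩ := exists_prefix_of_mem_factors hN0 hN (m := m + 1) hxw (by simp)
    have hc := (isChain_of_mem_factors hW.isLoop hxw).prefix huv
    refine ⟨u ++ v, ⟨hc, u, ⟨(List.isChain_append.1 hc).1, hu⟩, v, hv, rfl⟩, ?_, hXt x hx _⟩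
    obtain ⟨z, hz⟩ := huv
    refine (StartsWith.of_append (v := z) ?_).1
    rw [hz]
    exact startsWith_firstLetters _ _
  · refine (h.tsum_append_le (fun w hw => hw) hs).trans ?_
    rw [Finset.tsum_subtype' _ fun w => R w ^ s]
    exact (mul_le_mul_right (h.sum_wordPow_le hN hW.isLoop hs _) _).trans (hm _ (by omega)).le

end Shifts

/-! ### Conformal derivatives and local similarity. -/

section Derivative

open Filter Topology

variable {E : Type*} [NormedAddCommGroup E] [NormedSpace ℝ E]

theorem norm_fderiv_apply_of_conformalAt [Nontrivial E] {f : E → E} {x : E}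
    (h : ConformalAt f x) :
    0 < ‖fderiv ℝ f x‖ ∧ ∀ v, ‖fderiv ℝ f x v‖ = ‖fderiv ℝ f x‖ * ‖v‖ := by
  obtain ⟨f', hf', c, hc, li, rfl⟩ := h
  have hv : ∀ v, ‖(c • li.toContinuousLinearMap) v‖ = |c| * ‖v‖ := fun v => by
    simp [norm_smul]
  have hn := ContinuousLinearMap.homothety_norm _ hv
  rw [hf'.fderiv, hn]
  exact ⟨abs_pos.2 hc, hv⟩

theorem exists_equiv_of_norm_apply [FiniteDimensional ℝ E] {T : E →L[ℝ] E} {a : ℝ} (ha : 0 < a)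
    (hT : ∀ v, ‖T v‖ = a * ‖v‖) : ∃ e : E ≃L[ℝ] E, (e : E →L[ℝ] E) = T := by
  have hinj : Function.Injective (T : E →ₗ[ℝ] E) := by
    rw [injective_iff_map_eq_zero]
    intro v hv
    have := hT v
    rw [show T v = 0 from hv, norm_zero, eq_comm, mul_eq_zero, norm_eq_zero] at this
    exact this.resolve_left ha.ne'
  refine ⟨(LinearEquiv.ofInjectiveEndo _ hinj).toContinuousLinearEquiv, ?_⟩
  ext v
  rfl

theorem norm_inverse_of_norm_apply [Nontrivial E] [FiniteDimensional ℝ E] {T : E →L[ℝ] E} {a : ℝ}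
    (ha : 0 < a) (hT : ∀ v, ‖T v‖ = a * ‖v‖) : ‖T.inverse‖ = a⁻¹ := by
  obtain ⟨e, rfl⟩ := exists_equiv_of_norm_apply ha hT
  rw [ContinuousLinearMap.inverse_equiv]
  refine ContinuousLinearMap.homothety_norm _ fun w => ?_
  have := hT (e.symm w)
  simp only [ContinuousLinearEquiv.coe_coe, ContinuousLinearEquiv.apply_symm_apply] at this ⊢
  rw [this, inv_mul_cancel_left₀ ha.ne']

/-- A map with conformal continuous derivative is uniformly almost a similarity at small scales
on compact sets. -/
theorem exists_uniform_scale [Nontrivial E] {f : E → E} {U P : Set E} (hU : IsOpen U)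
    (hP : IsCompact P) (hPU : P ⊆ U) (hf : ContDiffOn ℝ 1 f U) (hc : ∀ x ∈ U, ConformalAt f x)
    {κ c : ℝ} (hκ : 0 < κ) (hκP : ∀ x ∈ P, κ ≤ ‖fderiv ℝ f x‖) (h1 : 1 < c) :
    ∃ δ > 0, ∀ x ∈ P, ∀ y ∈ P, dist x y ≤ δ →
      dist (f x) (f y) ≤ c * ‖fderiv ℝ f x‖ * dist x y ∧
        ‖fderiv ℝ f x‖ * dist x y ≤ c * dist (f x) (f y) := by
  -- Strict differentiability at `z` and continuity of the derivative norm each cost `η`; with this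
  -- choice the total error `2 * η` is absorbed by the factor `c`, in both directions.
  obtain ⟨η, hη, hηc⟩ : ∃ η > 0, 2 * η * c = (c - 1) * κ :=
    ⟨(c - 1) * κ / (2 * c), by have := sub_pos.2 h1; positivity, by field_simp⟩
  have hloc : ∀ z ∈ P, ∃ V : Set E, IsOpen V ∧ z ∈ V ∧ ∀ x ∈ P ∩ V, ∀ y ∈ P ∩ V,
      dist (f x) (f y) ≤ c * ‖fderiv ℝ f x‖ * dist x y ∧
        ‖fderiv ℝ f x‖ * dist x y ≤ c * dist (f x) (f y) := by
    intro z hz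
    have hzU := hU.mem_nhds (hPU hz)
    have hstrict : HasStrictFDerivAt f (fderiv ℝ f z) z :=
      (hf.contDiffAt hzU).hasStrictFDerivAt one_ne_zero
    have hcont : ContinuousAt (fun x => ‖fderiv ℝ f x‖) z :=
      ((hf.continuousOn_fderiv_of_isOpen hU le_rfl).continuousAt hzU).norm
    have e1 := hstrict.isLittleO.def hη
    have e2 : ∀ᶠ x in 𝓝 z, ‖fderiv ℝ f x‖ < ‖fderiv ℝ f z‖ + η ∧
        ‖fderiv ℝ f z‖ - η < ‖fderiv ℝ f x‖ :=
      (hcont.eventually_lt_const (lt_add_of_pos_right _ hη)).and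
        (hcont.eventually_const_lt (sub_lt_self _ hη))
    rw [nhds_prod_eq] at e1
    obtain ⟨V₁, hV₁, hV₁'⟩ := Filter.eventually_prod_self_iff'.1 e1
    obtain ⟨V, hV, hVo, hzV⟩ := mem_nhds_iff.1 (Filter.inter_mem hV₁ e2)
    refine ⟨V, hVo, hzV, fun x hx y hy => ?_⟩
    have h3 := hV₁' x (hV hx.2).1 y (hV hy.2).1
    obtain ⟨h4, h5⟩ := (hV hx.2).2
    have hκx := hκP x hx.1
    have h6 := (norm_fderiv_apply_of_conformalAt (hc z (hPU hz))).2 (x - y)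
    have h7 := abs_le.1 ((abs_norm_sub_norm_le (f x - f y) (fderiv ℝ f z (x - y))).trans h3)
    rw [h6] at h7
    rw [dist_eq_norm, dist_eq_norm]
    set lx := ‖fderiv ℝ f x‖
    set lz := ‖fderiv ℝ f z‖
    have hd := norm_nonneg (x - y)
    set D := ‖x - y‖
    set D' := ‖f x - f y‖
    have h8 : (c - 1) * κ ≤ (c - 1) * lx := mul_le_mul_of_nonneg_left hκx (by linarith)
    have h9 : 2 * η ≤ (c - 1) * lx := by nlinarith
    have h10 : lx ≤ c * (lx - 2 * η) := by linarith
    have h11 : (lx - 2 * η) * D ≤ D' := by nlinarith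
    constructor
    · nlinarith
    · calc lx * D ≤ c * (lx - 2 * η) * D := mul_le_mul_of_nonneg_right h10 hd
        _ = c * ((lx - 2 * η) * D) := by ring
        _ ≤ c * D' := mul_le_mul_of_nonneg_left h11 (by linarith)
  choose! V hVo hzV hV using hloc
  -- A Lebesgue number makes the local scales uniform on `P`, with no convexity needed.
  obtain ⟨δ, hδ, hball⟩ := lebesgue_number_lemma_of_metric (s := P) (c := fun z : P => V z) hP
    (fun z => hVo z z.2) fun x hx => mem_iUnion.2 ⟨⟨x, hx⟩, hzV x hx⟩
  refine ⟨δ / 2, half_pos hδ, fun x hx y hy hxy => ?_⟩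
  obtain ⟨z, hz⟩ := hball x hx
  refine hV z z.2 x ⟨hx, hz (Metric.mem_ball_self hδ)⟩ y ⟨hy, hz ?_⟩
  rw [Metric.mem_ball, dist_comm]
  linarith

theorem isOpen_image_of_eqOn [Nontrivial E] [FiniteDimensional ℝ E] {f g : E → E} {U P : Set E}
    (hU : IsOpen U) (hPU : P ⊆ U) (hf : ContDiffOn ℝ 1 f U) (hc : ∀ x ∈ U, ConformalAt f x)
    (hfg : EqOn f g P) : IsOpen (g '' interior P) := by
  rw [isOpen_iff_mem_nhds]
  rintro _ ⟨x, hx, rfl⟩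
  have hxU := hU.mem_nhds (hPU (interior_subset hx))
  have hstrict : HasStrictFDerivAt f (fderiv ℝ f x) x :=
    (hf.contDiffAt hxU).hasStrictFDerivAt one_ne_zero
  obtain ⟨h0, h1⟩ := norm_fderiv_apply_of_conformalAt (hc x (hPU (interior_subset hx)))
  obtain ⟨e, he⟩ := exists_equiv_of_norm_apply h0 h1
  rw [← he] at hstrict
  rw [← (hfg.mono interior_subset).image_eq, ← hfg (interior_subset hx),
    ← hstrict.map_nhds_eq_of_equiv]
  exact Filter.image_mem_map (isOpen_interior.mem_nhds hx)

end Derivative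

/-! ### Metric estimates extracted from conformality. -/

/-- The metric data extracted from conformality: `lam e` is the norm of the derivative of the
generator `φ e` on the piece of `e`. -/
structure Construction.IsScaled {A : Type*} {X : Set (ℕ → A)} {E : Type*} [MetricSpace E]
    (Φ : Construction X E) (lam : A → E → ℝ) (κ : ℝ) (θ : ℝ≥0) (L α : ℝ) : Prop where
  pos : 0 < κ
  le_lam : ∀ e, ∀ x ∈ Φ.piece e, κ ≤ lam e x
  lam_le : ∀ e, ∀ x ∈ Φ.piece e, lam e x ≤ θ
  lt_one : θ < 1
  lipschitz : ∀ e, LipschitzOnWith θ (Φ.φ e) (Φ.piece e)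
  L_nonneg : 0 ≤ L
  α_pos : 0 < α
  holder : ∀ e, ∀ x ∈ Φ.piece e, ∀ y ∈ Φ.piece e,
    lam e x ≤ Real.exp (L * dist x y ^ α) * lam e y
  near : ∀ c : ℝ, 1 < c → ∃ δ > 0, ∀ e, ∀ x ∈ Φ.piece e, ∀ y ∈ Φ.piece e, dist x y ≤ δ →
    dist (Φ.φ e x) (Φ.φ e y) ≤ c * lam e x * dist x y ∧
      lam e x * dist x y ≤ c * dist (Φ.φ e x) (Φ.φ e y)

namespace Construction.IsConformal

variable {A : Type*} {X : Set (ℕ → A)} {d : ℕ} {Φ : Construction X (EuclideanSpace ℝ (Fin d))}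

/-- The axis of a cone is a unit vector, so `d` is positive. -/
theorem nontrivial (h : Φ.IsConformal) : Nontrivial (EuclideanSpace ℝ (Fin d)) := by
  obtain ⟨γ, l, -, -, -, hc⟩ := h.cone
  obtain ⟨y, hy⟩ := Φ.nonempty_Y
  obtain ⟨u, hu, -⟩ := hc y hy
  exact ⟨u, 0, fun h0 => by simp [h0] at hu⟩

theorem isOpen_image (h : Φ.IsConformal) (e : A) : IsOpen (Φ.φ e '' interior (Φ.piece e)) := by
  have := h.nontrivial
  obtain ⟨W, ψ, hψ, -⟩ := h.extension
  obtain ⟨hW, -, hPW, heq, hd, hc, -⟩ := hψ e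
  exact isOpen_image_of_eqOn hW hPW hd hc heq

theorem nonempty_interior (h : Φ.IsConformal) (e : A) : (interior (Φ.piece e)).Nonempty := by
  rw [← closure_nonempty_iff, h.closure_interior_piece]
  exact Φ.nonempty_piece e

open Filter Topology in
theorem exists_isScaled [Finite A] (h : Φ.IsConformal) :
    ∃ lam κ θ L α, Φ.IsScaled lam κ θ L α := by
  have := h.nontrivial
  obtain ⟨W, ψ, hψ, L, α, hL, hα, hH⟩ := h.extension
  obtain ⟨θ, hθ, hlip⟩ := Φ.contracting
  let lam : A → EuclideanSpace ℝ (Fin d) → ℝ := fun e x => ‖fderiv ℝ (ψ e) x‖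
  have hconf : ∀ e, ∀ x ∈ Φ.piece e, 0 < lam e x ∧
      ∀ v, ‖fderiv ℝ (ψ e) x v‖ = lam e x * ‖v‖ := fun e x hx =>
    norm_fderiv_apply_of_conformalAt ((hψ e).2.2.2.2.2.1 x ((hψ e).2.2.1 hx))
  have hcont : ∀ e, ContinuousOn (lam e) (Φ.piece e) := fun e =>
    ((hψ e).2.2.2.2.1.continuousOn_fderiv_of_isOpen (hψ e).1 le_rfl).norm.mono (hψ e).2.2.1
  obtain ⟨κ, hκ, hκ0⟩ : ∃ κ : ℝ, (∀ e, ∀ x ∈ Φ.piece e, κ ≤ lam e x) ∧ 0 < κ := by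
    have : ∀ e, ∀ᶠ κ in 𝓝[>] (0 : ℝ), ∀ x ∈ Φ.piece e, κ ≤ lam e x := fun e => by
      obtain ⟨z, hz, hmin⟩ := (Φ.isCompact_piece e).exists_isMinOn (Φ.nonempty_piece e) (hcont e)
      filter_upwards [Ioc_mem_nhdsGT (hconf e z hz).1] with κ hκ x hx
      exact hκ.2.trans (hmin hx)
    exact ((eventually_all.2 this).and self_mem_nhdsWithin).exists
  refine ⟨lam, κ, θ, L, α, hκ0, hκ, fun e x hx => ?_, hθ, hlip, by linarith, hα,
    fun e x hx y hy => ?_, fun c hc => ?_⟩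
  -- The Lipschitz constant bounds the derivative on the interior, and continuity carries the bound
  -- to the whole piece.
  · have hx' : x ∈ closure (interior (Φ.piece e)) := by rwa [h.closure_interior_piece]
    refine ContinuousWithinAt.closure_le hx'
      ((hcont e x hx).mono interior_subset) continuousWithinAt_const fun z hz => ?_
    refine norm_fderiv_le_of_lipschitzOn ℝ (mem_interior_iff_mem_nhds.1 hz) fun u hu v hv => ?_
    rw [(hψ e).2.2.2.1 hu, (hψ e).2.2.2.1 hv]
    exact hlip e hu hv
  · have h1 := hH e x hx y hy
    -- By conformality the inverse derivative has norm `(lam e z)⁻¹`, so the Hölder bound becomes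
    -- relative: `lam e x ≤ (1 + L * ‖x - y‖ ^ α) * lam e y`.
    have hsup : (⨆ z : Φ.piece e, ‖(fderiv ℝ (ψ e) z).inverse‖)⁻¹ ≤ lam e y := by
      have hn : ∀ z : Φ.piece e, ‖(fderiv ℝ (ψ e) z).inverse‖ = (lam e z)⁻¹ := fun z =>
        norm_inverse_of_norm_apply (hconf e z z.2).1 (hconf e z z.2).2
      refine inv_le_of_inv_le₀ (hconf e y hy).1 ?_
      rw [← hn ⟨y, hy⟩]
      refine le_ciSup (f := fun z : Φ.piece e => ‖(fderiv ℝ (ψ e) z).inverse‖) ?_ ⟨y, hy⟩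
      refine ⟨κ⁻¹, ?_⟩
      rintro _ ⟨z, rfl⟩
      simp only [hn]
      exact inv_anti₀ hκ0 (hκ e z z.2)
    have h2 : lam e x - lam e y ≤ L * lam e y * ‖x - y‖ ^ α := by
      refine (le_abs_self _).trans (h1.trans ?_)
      gcongr
    have h3 := Real.add_one_le_exp (L * dist x y ^ α)
    rw [dist_eq_norm] at h3 ⊢
    have h4 := (hconf e y hy).1
    nlinarith
  · have : ∀ e, ∀ᶠ δ in 𝓝[>] (0 : ℝ), ∀ x ∈ Φ.piece e, ∀ y ∈ Φ.piece e, dist x y ≤ δ →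
        dist (Φ.φ e x) (Φ.φ e y) ≤ c * lam e x * dist x y ∧
          lam e x * dist x y ≤ c * dist (Φ.φ e x) (Φ.φ e y) := fun e => by
      obtain ⟨hW, -, hPW, heq, hd, hc', -⟩ := hψ e
      obtain ⟨δ, hδ, H⟩ := exists_uniform_scale hW (Φ.isCompact_piece e) hPW hd hc' hκ0 (hκ e) hc
      filter_upwards [Ioc_mem_nhdsGT hδ] with δ' hδ' x hx y hy hxy
      rw [← heq hx, ← heq hy]
      exact H x hx y hy (hxy.trans hδ'.2)
    obtain ⟨δ, h1, h2⟩ := ((eventually_all.2 this).and self_mem_nhdsWithin).exists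
    exact ⟨δ, h2, h1⟩

end Construction.IsConformal

/-! ### Compositions along words, distortion and the coding map. -/

/-- The letter `f` may follow the letter `e` in points of `X`. -/
def Follows {A : Type*} (X : Set (ℕ → A)) (e f : A) : Prop := [e, f] ∈ language X

theorem isChain_firstLetters {A : Type*} {X : Set (ℕ → A)} {x : ℕ → A} (hx : x ∈ X) (n : ℕ) :
    (firstLetters x n).IsChain (Follows X) := by
  rw [List.isChain_iff_getElem]
  intro i hi
  rw [getElem_firstLetters, getElem_firstLetters]
  exact pair_mem_language hx i

theorem StartsWith.isChain {A : Type*} {X : Set (ℕ → A)} {x : ℕ → A} {w : List A}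
    (h : StartsWith x w) (hx : x ∈ X) : w.IsChain (Follows X) :=
  h ▸ isChain_firstLetters hx _

namespace Construction

variable {A : Type*} {X : Set (ℕ → A)} {E : Type*} [MetricSpace E] (Φ : Construction X E)

/-- The domain of the composition along a word. -/
def domain (w : List A) : Set E := {x ∈ Φ.Y | ∀ e ∈ w.getLast?, x ∈ Φ.piece e}

/-- The multiplicative cocycle generated by `lam`, i.e. the norm of the derivative of the
composition along a word. -/
def scale (Φ : Construction X E) (lam : A → E → ℝ) : List A → E → ℝ
  | [], _ => 1
  | a :: w, x => lam a (Φ.wordMap w x) * Φ.scale lam w x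

/-- The supremum of the norm of the derivative of the composition along a word. -/
noncomputable def weight (lam : A → E → ℝ) (w : List A) : ℝ≥0∞ :=
  ⨆ x ∈ Φ.domain w, ENNReal.ofReal (Φ.scale lam w x)

variable {Φ}

theorem wordMap_append (u v : List A) (x : E) :
    Φ.wordMap (u ++ v) x = Φ.wordMap u (Φ.wordMap v x) := by
  induction u with
  | nil => rfl
  | cons a u ih => simp [wordMap, ih]

theorem scale_append (lam : A → E → ℝ) (u v : List A) (x : E) :
    Φ.scale lam (u ++ v) x = Φ.scale lam u (Φ.wordMap v x) * Φ.scale lam v x := by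
  induction u with
  | nil => simp [scale]
  | cons a u ih => simp [scale, ih, wordMap_append, mul_assoc]

theorem domain_append {u v : List A} (hv : v ≠ []) : Φ.domain (u ++ v) = Φ.domain v := by
  simp [domain, List.getLast?_append_of_ne_nil _ hv]

theorem domain_cons_subset (a : A) (w : List A) : Φ.domain (a :: w) ⊆ Φ.domain w := by
  cases w with
  | nil => exact fun x hx => ⟨hx.1, by simp⟩
  | cons b w =>
    rw [show a :: b :: w = [a] ++ (b :: w) from rfl, domain_append (by simp)]

theorem nonempty_domain (w : List A) : (Φ.domain w).Nonempty := by
  cases h : w.getLast? with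
  | none =>
    obtain ⟨y, hy⟩ := Φ.nonempty_Y
    exact ⟨y, hy, by simp [h]⟩
  | some e =>
    obtain ⟨y, hy⟩ := Φ.nonempty_piece e
    refine ⟨y, Φ.piece_subset e hy, fun f hf => ?_⟩
    rw [h] at hf
    obtain rfl : e = f := by simpa using hf
    exact hy

theorem wordMap_mem_piece {a : A} {w : List A} (hw : (a :: w).IsChain (Follows X)) {x : E}
    (hx : x ∈ Φ.domain (a :: w)) : Φ.wordMap w x ∈ Φ.piece a := by
  induction w generalizing a with
  | nil => exact hx.2 a (by simp)
  | cons b w ih =>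
    obtain ⟨hab, hw'⟩ := List.isChain_cons_cons.1 hw
    exact Φ.mapsTo_piece a b hab (ih hw' (domain_cons_subset _ _ hx))

theorem domain_append_subset (u v : List A) : Φ.domain (u ++ v) ⊆ Φ.domain v := by
  induction u with
  | nil => exact subset_rfl
  | cons a u ih => exact (domain_cons_subset _ _).trans ih

theorem wordMap_mem_Y {w : List A} (hw : w.IsChain (Follows X)) {x : E}
    (hx : x ∈ Φ.domain w) : Φ.wordMap w x ∈ Φ.Y := by
  cases w with
  | nil => exact hx.1
  | cons a w => exact Φ.mapsTo_φ a (wordMap_mem_piece hw hx)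

theorem wordMap_mem_domain {u v : List A} (hw : (u ++ v).IsChain (Follows X)) {x : E}
    (hx : x ∈ Φ.domain (u ++ v)) : Φ.wordMap v x ∈ Φ.domain u := by
  refine ⟨wordMap_mem_Y (List.isChain_append.1 hw).2.1 (domain_append_subset u v hx),
    fun e he => ?_⟩
  obtain ⟨u', rfl⟩ := List.getLast?_eq_some_iff.1 he
  rw [List.append_assoc] at hw hx
  exact wordMap_mem_piece (List.isChain_append.1 hw).2.1 (domain_append_subset u' _ hx)

theorem injOn_wordMap {w : List A} (hw : w.IsChain (Follows X)) :
    InjOn (Φ.wordMap w) (Φ.domain w) := by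
  induction w with
  | nil => exact injOn_id _
  | cons a w ih =>
    intro x hx y hy hxy
    exact ih hw.tail (domain_cons_subset _ _ hx) (domain_cons_subset _ _ hy)
      (Φ.injOn_φ a (wordMap_mem_piece hw hx) (wordMap_mem_piece hw hy) hxy)

theorem dist_le_diam {w : List A} {x y : E} (hx : x ∈ Φ.domain w) (hy : y ∈ Φ.domain w) :
    dist x y ≤ Metric.diam Φ.Y :=
  Metric.dist_le_diam_of_mem Φ.isCompact_Y.isBounded hx.1 hy.1

namespace IsScaled

variable {lam : A → E → ℝ} {κ : ℝ} {θ : ℝ≥0} {L α : ℝ}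

theorem pow_le_scale (h : Φ.IsScaled lam κ θ L α) {w : List A} (hw : w.IsChain (Follows X)) {x : E}
    (hx : x ∈ Φ.domain w) : κ ^ w.length ≤ Φ.scale lam w x := by
  induction w with
  | nil => simp [scale]
  | cons a w ih =>
    rw [List.length_cons, pow_succ', scale]
    have h1 := h.le_lam a _ (wordMap_mem_piece hw hx)
    exact mul_le_mul h1 (ih hw.tail (domain_cons_subset _ _ hx)) (pow_nonneg h.pos.le _)
      (h.pos.le.trans h1)

theorem scale_pos (h : Φ.IsScaled lam κ θ L α) {w : List A} (hw : w.IsChain (Follows X)) {x : E}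
    (hx : x ∈ Φ.domain w) : 0 < Φ.scale lam w x :=
  (pow_pos h.pos _).trans_le (h.pow_le_scale hw hx)

theorem scale_le_pow (h : Φ.IsScaled lam κ θ L α) {w : List A} (hw : w.IsChain (Follows X)) {x : E}
    (hx : x ∈ Φ.domain w) : Φ.scale lam w x ≤ (θ : ℝ) ^ w.length := by
  induction w with
  | nil => simp [scale]
  | cons a w ih =>
    rw [List.length_cons, pow_succ', scale]
    have hx' := domain_cons_subset _ _ hx
    exact mul_le_mul (h.lam_le a _ (wordMap_mem_piece hw hx)) (ih hw.tail hx')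
      (h.scale_pos hw.tail hx').le θ.coe_nonneg

theorem dist_wordMap_le (h : Φ.IsScaled lam κ θ L α) {w : List A} (hw : w.IsChain (Follows X))
    {x y : E} (hx : x ∈ Φ.domain w) (hy : y ∈ Φ.domain w) :
    dist (Φ.wordMap w x) (Φ.wordMap w y) ≤ (θ : ℝ) ^ w.length * dist x y := by
  induction w with
  | nil => simp [wordMap]
  | cons a w ih =>
    rw [List.length_cons, pow_succ', mul_assoc]
    refine ((h.lipschitz a).dist_le_mul _ (wordMap_mem_piece hw hx) _
      (wordMap_mem_piece hw hy)).trans ?_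
    exact mul_le_mul_of_nonneg_left
      (ih hw.tail (domain_cons_subset _ _ hx) (domain_cons_subset _ _ hy)) θ.coe_nonneg

theorem pow_le_one (h : Φ.IsScaled lam κ θ L α) (n : ℕ) : (θ : ℝ) ^ n ≤ 1 :=
  pow_le_one₀ θ.coe_nonneg (by exact_mod_cast h.lt_one.le)

/-- Bounded distortion. -/
theorem exists_distortion (h : Φ.IsScaled lam κ θ L α) :
    ∃ K : ℝ, 1 ≤ K ∧ ∀ w : List A, w.IsChain (Follows X) → ∀ x ∈ Φ.domain w, ∀ y ∈ Φ.domain w,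
      Φ.scale lam w x ≤ K * Φ.scale lam w y := by
  set D := Metric.diam Φ.Y
  have hD : 0 ≤ D := Metric.diam_nonneg
  set q : ℝ := (θ : ℝ) ^ α with hq
  have hq0 : 0 ≤ q := by positivity
  have hq1 : q < 1 := Real.rpow_lt_one θ.coe_nonneg (by exact_mod_cast h.lt_one) h.α_pos
  have hLD : 0 ≤ L * D ^ α := mul_nonneg h.L_nonneg (by positivity)
  -- Each letter contributes its Hölder exponent at a distance contracted by `θ ^ length`, so the
  -- exponents form a geometric series of ratio `q = θ ^ α`.
  have key : ∀ w : List A, w.IsChain (Follows X) → ∀ x ∈ Φ.domain w, ∀ y ∈ Φ.domain w,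
      Φ.scale lam w x ≤
        Real.exp (L * D ^ α * ∑ k ∈ Finset.range w.length, q ^ k) * Φ.scale lam w y := by
    intro w hw x hx y hy
    induction w with
    | nil => simp [scale]
    | cons a w ih =>
      have hx' := domain_cons_subset _ _ hx
      have hy' := domain_cons_subset _ _ hy
      have hxa := wordMap_mem_piece hw hx
      have hya := wordMap_mem_piece hw hy
      have h1 := h.holder a _ hxa _ hya
      have h2 := ih hw.tail hx' hy'
      have h3 : L * dist (Φ.wordMap w x) (Φ.wordMap w y) ^ α ≤ L * D ^ α * q ^ w.length := by
        rw [mul_assoc]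
        refine mul_le_mul_of_nonneg_left ?_ h.L_nonneg
        rw [hq, ← Real.rpow_natCast, ← Real.rpow_mul θ.coe_nonneg, mul_comm α, Real.rpow_mul
          θ.coe_nonneg, Real.rpow_natCast, mul_comm, ← Real.mul_rpow (by positivity) hD]
        refine Real.rpow_le_rpow dist_nonneg ((h.dist_wordMap_le hw.tail hx' hy').trans ?_)
          h.α_pos.le
        exact mul_le_mul_of_nonneg_left (dist_le_diam hx hy) (by positivity)
      rw [scale, scale, List.length_cons, Finset.sum_range_succ, mul_add, Real.exp_add]
      have h4 : 0 ≤ lam a (Φ.wordMap w y) := h.pos.le.trans (h.le_lam a _ hya)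
      calc lam a (Φ.wordMap w x) * Φ.scale lam w x
          ≤ (Real.exp (L * D ^ α * q ^ w.length) * lam a (Φ.wordMap w y)) *
            (Real.exp (L * D ^ α * ∑ k ∈ Finset.range w.length, q ^ k) * Φ.scale lam w y) := by
            refine mul_le_mul (h1.trans ?_) h2 (h.scale_pos hw.tail hx').le (by positivity)
            exact mul_le_mul_of_nonneg_right (Real.exp_le_exp.2 h3) h4
        _ = _ := by ring
  refine ⟨Real.exp (L * D ^ α * (1 - q)⁻¹), Real.one_le_exp ?_, fun w hw x hx y hy => ?_⟩
  · have := sub_pos.2 hq1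
    positivity
  · refine (key w hw x hx y hy).trans (mul_le_mul_of_nonneg_right ?_ (h.scale_pos hw hy).le)
    refine Real.exp_le_exp.2 (mul_le_mul_of_nonneg_left ?_ hLD)
    rw [← tsum_geometric_of_lt_one hq0 hq1]
    exact (summable_geometric_of_lt_one hq0 hq1).sum_le_tsum _ fun _ _ => pow_nonneg hq0 _

theorem scale_le_weight {w : List A} {x : E} (hx : x ∈ Φ.domain w) :
    ENNReal.ofReal (Φ.scale lam w x) ≤ Φ.weight lam w :=
  le_iSup₂ (f := fun x (_ : x ∈ Φ.domain w) => ENNReal.ofReal (Φ.scale lam w x)) x hx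

theorem exists_isWeight (h : Φ.IsScaled lam κ θ L α) :
    ∃ K : ℝ≥0∞, IsWeight (Follows X) (Φ.weight lam) K θ ∧
      ∀ w : List A, w.IsChain (Follows X) → ∀ x ∈ Φ.domain w,
        Φ.weight lam w ≤ K * ENNReal.ofReal (Φ.scale lam w x) := by
  obtain ⟨K, hK1, hK⟩ := h.exists_distortion
  have hdist : ∀ w : List A, w.IsChain (Follows X) → ∀ x ∈ Φ.domain w,
      Φ.weight lam w ≤ ENNReal.ofReal K * ENNReal.ofReal (Φ.scale lam w x) := by
    intro w hw x hx
    refine iSup₂_le fun y hy => ?_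
    rw [← ENNReal.ofReal_mul (by linarith)]
    exact ENNReal.ofReal_le_ofReal (hK w hw y hy x hx)
  refine ⟨ENNReal.ofReal K, ⟨by simpa using hK1, ENNReal.ofReal_ne_top, by exact_mod_cast h.lt_one,
    ?_, ?_, ?_, ?_, ?_⟩, hdist⟩
  · simp only [weight, scale, ENNReal.ofReal_one]
    exact biSup_const (nonempty_domain [])
  · intro w hw
    obtain ⟨x, hx⟩ := Φ.nonempty_domain w
    exact ((ENNReal.ofReal_pos.2 (h.scale_pos hw hx)).trans_le (scale_le_weight hx)).ne'
  · intro w hw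
    refine iSup₂_le fun x hx => (ENNReal.ofReal_le_ofReal (h.scale_le_pow hw hx)).trans_eq ?_
    rw [ENNReal.ofReal_pow θ.coe_nonneg, ENNReal.ofReal_coe_nnreal]
  · intro u v huv
    refine iSup₂_le fun x hx => ?_
    have hx' := wordMap_mem_domain huv hx
    rw [scale_append, ENNReal.ofReal_mul (h.scale_pos (List.isChain_append.1 huv).1 hx').le]
    exact mul_le_mul' (scale_le_weight hx') (scale_le_weight (domain_append_subset u v hx))
  · intro u v huv
    rcases eq_or_ne v [] with rfl | hv
    · rw [List.append_nil] at huv ⊢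
      have : Φ.weight lam [] = 1 := by
        simp only [weight, scale, ENNReal.ofReal_one]
        exact biSup_const (nonempty_domain [])
      rw [this, mul_one]
      exact le_mul_of_one_le_left' (by simpa using hK1)
    · rw [weight, weight, ENNReal.mul_iSup]
      refine iSup_le fun x => ?_
      rw [ENNReal.mul_iSup]
      refine iSup_le fun hx => ?_
      have hx2 : x ∈ Φ.domain (u ++ v) := by rwa [domain_append hv]
      have hx' := wordMap_mem_domain huv hx2
      have huc := (List.isChain_append.1 huv).1
      refine (mul_le_mul_left (hdist u huc _ hx') _).trans ?_
      rw [mul_assoc, ← ENNReal.ofReal_mul (h.scale_pos huc hx').le, ← scale_append]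
      exact mul_le_mul_right (scale_le_weight hx2) _

/-- Compositions contract small distances at least as little as the scale says, up to a
subexponential factor. -/
theorem scale_mul_dist_le (h : Φ.IsScaled lam κ θ L α) {c δ : ℝ} (hc : 0 ≤ c)
    (hδ : ∀ e, ∀ x ∈ Φ.piece e, ∀ y ∈ Φ.piece e, dist x y ≤ δ →
      lam e x * dist x y ≤ c * dist (Φ.φ e x) (Φ.φ e y))
    {w : List A} (hw : w.IsChain (Follows X)) {x y : E} (hx : x ∈ Φ.domain w)
    (hy : y ∈ Φ.domain w) (hxy : dist x y ≤ δ) :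
    Φ.scale lam w x * dist x y ≤ c ^ w.length * dist (Φ.wordMap w x) (Φ.wordMap w y) := by
  induction w with
  | nil => simp [scale, wordMap]
  | cons a w ih =>
    have hx' := domain_cons_subset _ _ hx
    have hy' := domain_cons_subset _ _ hy
    have hxa := wordMap_mem_piece hw hx
    have hya := wordMap_mem_piece hw hy
    have h1 : dist (Φ.wordMap w x) (Φ.wordMap w y) ≤ δ :=
      (h.dist_wordMap_le hw.tail hx' hy').trans
        ((mul_le_of_le_one_left dist_nonneg (h.pow_le_one _)).trans hxy)
    have h2 : 0 ≤ lam a (Φ.wordMap w x) := h.pos.le.trans (h.le_lam a _ hxa)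
    calc Φ.scale lam (a :: w) x * dist x y
        = lam a (Φ.wordMap w x) * (Φ.scale lam w x * dist x y) := by rw [scale, mul_assoc]
      _ ≤ lam a (Φ.wordMap w x) * (c ^ w.length * dist (Φ.wordMap w x) (Φ.wordMap w y)) :=
          mul_le_mul_of_nonneg_left (ih hw.tail hx' hy') h2
      _ = c ^ w.length * (lam a (Φ.wordMap w x) * dist (Φ.wordMap w x) (Φ.wordMap w y)) := by ring
      _ ≤ c ^ w.length * (c * dist (Φ.wordMap (a :: w) x) (Φ.wordMap (a :: w) y)) :=
          mul_le_mul_of_nonneg_left (hδ a _ hxa _ hya h1) (pow_nonneg hc _)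
      _ = _ := by rw [List.length_cons, pow_succ, mul_assoc]

/-- Compositions contract distances at least as much as the scale says, up to a subexponential
factor. -/
theorem exists_dist_le_scale (h : Φ.IsScaled lam κ θ L α) {c : ℝ} (hc : 1 < c) :
    ∃ C : ℝ, 0 ≤ C ∧ ∀ w : List A, w.IsChain (Follows X) → ∀ x ∈ Φ.domain w, ∀ y ∈ Φ.domain w,
      dist (Φ.wordMap w x) (Φ.wordMap w y) ≤ C * c ^ w.length * Φ.scale lam w x * dist x y := by
  obtain ⟨δ, hδ0, hδ⟩ := h.near c hc
  set D := Metric.diam Φ.Y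
  obtain ⟨N, hN⟩ : ∃ N : ℕ, ∀ n ≥ N, (θ : ℝ) ^ n * D ≤ δ := by
    have := (tendsto_pow_atTop_nhds_zero_of_lt_one θ.coe_nonneg
      (by exact_mod_cast h.lt_one : (θ : ℝ) < 1)).mul_const D
    rw [zero_mul] at this
    exact Filter.eventually_atTop.1 (this.eventually_le_const hδ0)
  set B := max 1 κ⁻¹
  have hB : 1 ≤ B := le_max_left _ _
  refine ⟨B ^ N, by positivity, fun w hw x hx y hy => ?_⟩
  -- Only the innermost `N` maps may act on distances above `δ`; each of these costs `B`, while
  -- every later one costs `c`.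
  have key : dist (Φ.wordMap w x) (Φ.wordMap w y) ≤
      B ^ min w.length N * c ^ w.length * Φ.scale lam w x * dist x y := by
    induction w with
    | nil => simp [scale, wordMap]
    | cons a w ih =>
      have hx' := domain_cons_subset _ _ hx
      have hy' := domain_cons_subset _ _ hy
      have hxa := wordMap_mem_piece hw hx
      have hya := wordMap_mem_piece hw hy
      have ih := ih hw.tail hx' hy'
      have h2 : 0 < lam a (Φ.wordMap w x) := h.pos.trans_le (h.le_lam a _ hxa)
      set p := Φ.wordMap w x
      set q := Φ.wordMap w y
      have hs := (h.scale_pos hw.tail hx').le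
      rw [List.length_cons]
      have hstep : ∃ b : ℝ, 0 ≤ b ∧ dist (Φ.φ a p) (Φ.φ a q) ≤ b * lam a p * dist p q ∧
          b * B ^ min w.length N ≤ B ^ min (w.length + 1) N * c := by
        rcases le_or_gt N w.length with hNw | hNw
        · refine ⟨c, by linarith, (hδ a p hxa q hya ?_).1, ?_⟩
          · refine (h.dist_wordMap_le hw.tail hx' hy').trans (le_trans ?_ (hN _ hNw))
            exact mul_le_mul_of_nonneg_left (dist_le_diam hx hy) (by positivity)
          · rw [min_eq_right hNw, min_eq_right (by omega), mul_comm]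
        · refine ⟨B, by positivity, ?_, ?_⟩
          · refine ((h.lipschitz a).dist_le_mul _ hxa _ hya).trans
              (mul_le_mul_of_nonneg_right ?_ dist_nonneg)
            have h3 : (θ : ℝ) ≤ 1 := by exact_mod_cast h.lt_one.le
            have h4 : 1 ≤ B * lam a p := by
              calc (1 : ℝ) = κ⁻¹ * κ := (inv_mul_cancel₀ h.pos.ne').symm
                _ ≤ B * lam a p := mul_le_mul (le_max_right _ _) (h.le_lam a _ hxa) h.pos.le
                  (by positivity)
            linarith
          · rw [min_eq_left hNw.le, min_eq_left (by omega), pow_succ']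
            exact le_mul_of_one_le_right (by positivity) hc.le
      obtain ⟨b, hb0, hb1, hb2⟩ := hstep
      have hc0 : 0 ≤ c := by linarith
      calc dist (Φ.φ a p) (Φ.φ a q) ≤ b * lam a p * dist p q := hb1
        _ ≤ b * lam a p * (B ^ min w.length N * c ^ w.length * Φ.scale lam w x * dist x y) := by
            gcongr
        _ = (b * B ^ min w.length N) * (c ^ w.length * lam a p * Φ.scale lam w x * dist x y) := by
            ring
        _ ≤ (B ^ min (w.length + 1) N * c) *
            (c ^ w.length * lam a p * Φ.scale lam w x * dist x y) := by
            gcongr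
        _ = _ := by
            rw [scale, pow_succ]
            ring
  refine key.trans ?_
  have hs := (h.scale_pos hw hx).le
  have hc0 : 0 ≤ c := by linarith
  have : B ^ min w.length N ≤ B ^ N := pow_le_pow_right₀ hB (min_le_right _ _)
  gcongr

end IsScaled

/-- The coding map intertwines the shift with the generators. -/
theorem coding_eq_φ {x : ℕ → A} (hx : x ∈ X) (hx' : shift x ∈ X) :
    Φ.coding ⟨x, hx⟩ = Φ.φ (x 0) (Φ.coding ⟨shift x, hx'⟩) ∧
      Φ.coding ⟨shift x, hx'⟩ ∈ Φ.piece (x 0) := by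
  have hmem : ∀ n, Φ.coding ⟨shift x, hx'⟩ ∈ Φ.cylinder (shift x) n := fun n => by
    have : Φ.coding ⟨shift x, hx'⟩ ∈ ⋂ n, Φ.cylinder (shift x) n := by
      rw [Φ.iInter_cylinder ⟨shift x, hx'⟩]
      rfl
    exact mem_iInter.1 this n
  have hpiece := Φ.cylinder_shift_subset 0 x (pair_mem_language hx) (hmem 0)
  refine ⟨?_, hpiece⟩
  have : Φ.φ (x 0) (Φ.coding ⟨shift x, hx'⟩) ∈ ⋂ n, Φ.cylinder x n := by
    refine mem_iInter.2 fun n => ?_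
    cases n with
    | zero =>
      rw [cylinder_zero]
      exact mem_image_of_mem _ hpiece
    | succ n =>
      rw [cylinder_succ]
      exact mem_image_of_mem _ (hmem n)
  rw [Φ.iInter_cylinder ⟨x, hx⟩] at this
  exact this.symm

theorem coding_mem_Y {x : ℕ → A} (hx : x ∈ X) : Φ.coding ⟨x, hx⟩ ∈ Φ.Y := by
  have : Φ.coding ⟨x, hx⟩ ∈ ⋂ n, Φ.cylinder x n := by
    rw [Φ.iInter_cylinder ⟨x, hx⟩]
    rfl
  have h0 := mem_iInter.1 this 0
  rw [cylinder_zero] at h0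
  exact (Φ.mapsTo_φ _).image_subset h0

/-- Besides iterating `coding_eq_φ`, this places the coded tail in the domain of `w`, where the
estimates along words apply. -/
theorem coding_eq_wordMap (hX : ∀ x ∈ X, ∀ n, tail n x ∈ X) {x : ℕ → A} (hx : x ∈ X)
    {w : List A} (hw : StartsWith x w) :
    Φ.coding ⟨x, hx⟩ = Φ.wordMap w (Φ.coding ⟨tail w.length x, hX x hx _⟩) ∧
      Φ.coding ⟨tail w.length x, hX x hx _⟩ ∈ Φ.domain w := by
  induction w generalizing x with
  | nil =>
    simp only [List.length_nil, tail_zero]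
    exact ⟨rfl, coding_mem_Y hx, by simp⟩
  | cons a w ih =>
    have hs := StartsWith.of_append (u := [a]) (v := w) hw
    have hx0 : x 0 = a := by
      have := hs.1
      simpa [StartsWith, firstLetters] using this
    have hsx : shift x ∈ X := by
      rw [← tail_one]
      exact hX x hx 1
    have hsw : StartsWith (shift x) w := by
      rw [← tail_one]
      exact hs.2
    obtain ⟨h1, h2⟩ := ih hsx hsw
    obtain ⟨h3, h4⟩ := Φ.coding_eq_φ hx hsx
    have ht : tail w.length (shift x) = tail (a :: w).length x := by
      rw [← tail_one, ← tail_add, List.length_cons, add_comm]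
    simp only [ht] at h1 h2
    refine ⟨by rw [h3, h1, hx0]; rfl, h2.1, fun e he => ?_⟩
    cases w with
    | nil =>
      obtain rfl : a = e := by simpa using he
      rw [← hx0]
      simpa [wordMap, h1] using h4
    | cons b w =>
      rw [show a :: b :: w = [a] ++ (b :: w) from rfl,
        List.getLast?_append_of_ne_nil _ (by simp)] at he
      exact h2.2 e he

end Construction

/-! ### Weights against diameters, and upper bounds for the dimension. -/

theorem exists_factor {θ : ℝ≥0} (h0 : 0 < θ) (h1 : θ < 1) {η : ℝ} (hη : 0 < η) :
    ∃ c : ℝ, 1 < c ∧ ENNReal.ofReal c = (θ : ℝ≥0∞) ^ (-η) := by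
  refine ⟨(θ : ℝ) ^ (-η), Real.one_lt_rpow_of_pos_of_lt_one_of_neg (by exact_mod_cast h0)
    (by exact_mod_cast h1) (by linarith), ?_⟩
  rw [← ENNReal.ofReal_rpow_of_pos (by exact_mod_cast h0), ENNReal.ofReal_coe_nnreal]

/-- With `c = θ ^ (-η)`, the subexponential loss `c ^ length` is at most `R w ^ (-η)`, because `R w
≤ θ ^ length`. -/
theorem IsWeight.factor_pow_mul_le_one {A : Type*} {r : A → A → Prop} {R : List A → ℝ≥0∞}
    {K : ℝ≥0∞} {θ : ℝ≥0} (h : IsWeight r R K θ) (h0 : 0 < θ) {η : ℝ} (hη : 0 < η) {w : List A}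
    (hw : w.IsChain r) : ((θ : ℝ≥0∞) ^ (-η)) ^ w.length * R w ^ η ≤ 1 := by
  refine (mul_le_mul_right (ENNReal.rpow_le_rpow (h.le_pow w hw) hη.le) _).trans ?_
  rw [← ENNReal.rpow_natCast, ← ENNReal.rpow_natCast, ← ENNReal.rpow_mul, ← ENNReal.rpow_mul,
    ← ENNReal.rpow_add _ _ (by exact_mod_cast h0.ne') ENNReal.coe_ne_top]
  ring_nf
  simp

namespace Construction

section Metric

variable {A : Type*} {X : Set (ℕ → A)} {E : Type*} [MetricSpace E] {Φ : Construction X E}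
  {lam : A → E → ℝ} {κ : ℝ} {θ : ℝ≥0} {L α : ℝ}

theorem IsScaled.θ_pos [Nonempty A] (h : Φ.IsScaled lam κ θ L α) : 0 < θ := by
  obtain ⟨e⟩ := ‹Nonempty A›
  obtain ⟨x, hx⟩ := Φ.nonempty_piece e
  exact_mod_cast h.pos.trans_le ((h.le_lam e x hx).trans (h.lam_le e x hx))

theorem IsScaled.exists_ediam_le [Nonempty A] (h : Φ.IsScaled lam κ θ L α) {K : ℝ≥0∞}
    (hR : IsWeight (Follows X) (Φ.weight lam) K θ) {η : ℝ} (hη : 0 < η) :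
    ∃ C : ℝ≥0∞, C ≠ ⊤ ∧ ∀ w : List A, w.IsChain (Follows X) →
      Metric.ediam (Φ.wordMap w '' Φ.domain w) ≤ C * Φ.weight lam w ^ (1 - η) := by
  obtain ⟨c, hc, hcθ⟩ := exists_factor h.θ_pos h.lt_one hη
  obtain ⟨C, hC0, hC⟩ := h.exists_dist_le_scale hc
  refine ⟨ENNReal.ofReal (C * Metric.diam Φ.Y), ENNReal.ofReal_ne_top, fun w hw => ?_⟩
  refine Metric.ediam_le ?_
  rintro _ ⟨x, hx, rfl⟩ _ ⟨y, hy, rfl⟩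
  have hs := (h.scale_pos hw hx).le
  have hc0 : 0 ≤ c := by linarith
  calc edist (Φ.wordMap w x) (Φ.wordMap w y)
      ≤ ENNReal.ofReal ((C * Metric.diam Φ.Y) * c ^ w.length * Φ.scale lam w x) := by
        rw [edist_dist]
        refine ENNReal.ofReal_le_ofReal ((hC w hw x hx y hy).trans ?_)
        calc C * c ^ w.length * Φ.scale lam w x * dist x y
            ≤ C * c ^ w.length * Φ.scale lam w x * Metric.diam Φ.Y := by
              gcongr
              exact dist_le_diam hx hy
          _ = _ := by ring
    _ = ENNReal.ofReal (C * Metric.diam Φ.Y) * ((θ : ℝ≥0∞) ^ (-η)) ^ w.length *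
          ENNReal.ofReal (Φ.scale lam w x) := by
        have := Metric.diam_nonneg (s := Φ.Y)
        rw [ENNReal.ofReal_mul (by positivity), ENNReal.ofReal_mul (by positivity),
          ENNReal.ofReal_pow hc0, hcθ]
    _ ≤ ENNReal.ofReal (C * Metric.diam Φ.Y) * (((θ : ℝ≥0∞) ^ (-η)) ^ w.length *
          Φ.weight lam w) := by
        rw [mul_assoc]
        gcongr
        exact IsScaled.scale_le_weight hx
    _ ≤ _ := by
        gcongr
        conv_lhs => rw [← ENNReal.rpow_one (Φ.weight lam w), show (1 : ℝ) = η + (1 - η) by ring,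
          ENNReal.rpow_add _ _ (hR.ne_zero w hw) (hR.ne_top' hw), ← mul_assoc]
        exact mul_le_of_le_one_left zero_le (hR.factor_pow_mul_le_one h.θ_pos hη hw)

theorem IsScaled.exists_mul_edist_le [Nonempty A] (h : Φ.IsScaled lam κ θ L α) {K : ℝ≥0∞}
    (hR : IsWeight (Follows X) (Φ.weight lam) K θ)
    (hK : ∀ w : List A, w.IsChain (Follows X) → ∀ x ∈ Φ.domain w,
      Φ.weight lam w ≤ K * ENNReal.ofReal (Φ.scale lam w x)) {η : ℝ} (hη : 0 < η) :
    ∃ δ > 0, ∀ w : List A, w.IsChain (Follows X) → ∀ x ∈ Φ.domain w, ∀ y ∈ Φ.domain w,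
      dist x y ≤ δ →
      Φ.weight lam w ^ (1 + η) * edist x y ≤ K * edist (Φ.wordMap w x) (Φ.wordMap w y) := by
  obtain ⟨c, hc, hcθ⟩ := exists_factor h.θ_pos h.lt_one hη
  obtain ⟨δ, hδ0, hδ⟩ := h.near c hc
  refine ⟨δ, hδ0, fun w hw x hx y hy hxy => ?_⟩
  have hc0 : 0 ≤ c := by linarith
  have h1 := h.scale_mul_dist_le hc0 (fun e x hx y hy hxy => (hδ e x hx y hy hxy).2) hw hx hy hxy
  have h2 := ENNReal.ofReal_le_ofReal h1
  rw [ENNReal.ofReal_mul (h.scale_pos hw hx).le, ENNReal.ofReal_mul (by positivity),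
    ENNReal.ofReal_pow hc0, hcθ, ← edist_dist, ← edist_dist] at h2
  rw [add_comm, ENNReal.rpow_add _ _ (hR.ne_zero w hw) (hR.ne_top' hw), ENNReal.rpow_one]
  calc Φ.weight lam w ^ η * Φ.weight lam w * edist x y
      ≤ Φ.weight lam w ^ η * (K * ENNReal.ofReal (Φ.scale lam w x)) * edist x y := by
        gcongr
        exact hK w hw x hx
    _ = Φ.weight lam w ^ η * K * (ENNReal.ofReal (Φ.scale lam w x) * edist x y) := by ring
    _ ≤ Φ.weight lam w ^ η * K * (((θ : ℝ≥0∞) ^ (-η)) ^ w.length *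
          edist (Φ.wordMap w x) (Φ.wordMap w y)) := by gcongr
    _ = (((θ : ℝ≥0∞) ^ (-η)) ^ w.length * Φ.weight lam w ^ η) *
          (K * edist (Φ.wordMap w x) (Φ.wordMap w y)) := by ring
    _ ≤ _ := mul_le_of_le_one_left zero_le (hR.factor_pow_mul_le_one h.θ_pos hη hw)

theorem mem_limitSet {X' : Set (ℕ → A)} {y : E} :
    y ∈ Φ.limitSet X' ↔ ∃ x, ∃ hx : x ∈ X, x ∈ X' ∧ Φ.coding ⟨x, hx⟩ = y :=
  ⟨fun ⟨ω, hω, h⟩ => ⟨ω, ω.2, hω, h⟩, fun ⟨x, hx, hx', h⟩ => ⟨⟨x, hx⟩, hx', h⟩⟩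

/-- Concatenating `n` words of `F` multiplies the sums, which stay at most `1`, and lengthens the
words, so the covers become arbitrarily fine. -/
theorem exists_covers_of_le_length {R : List A → ℝ≥0∞} {K θ : ℝ≥0∞}
    (hR : IsWeight (Follows X) R K θ)
    {X' : Set (ℕ → A)} (hX' : X' ⊆ X) {F : Set (List A)} (hF0 : ∀ w ∈ F, w ≠ [])
    (hF : Covers F X') {s : ℝ} (hs : 0 ≤ s) (hsum : ∑' w : F, R w ^ s ≤ 1) (n : ℕ) :
    ∃ G : Set (List A), (∀ w ∈ G, n ≤ w.length ∧ w.IsChain (Follows X)) ∧ Covers G X' ∧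
      ∑' w : G, R w ^ s ≤ 1 := by
  induction n with
  | zero =>
    refine ⟨{[]}, by simp, fun x hx => ⟨[], rfl, by simp [StartsWith, firstLetters], ?_⟩, ?_⟩
    · rwa [List.length_nil, tail_zero]
    · rw [tsum_singleton [] fun w => R w ^ s, hR.nil, ENNReal.one_rpow]
  | succ n ih =>
    obtain ⟨G, hG, hGc, hGs⟩ := ih
    refine ⟨{w | w.IsChain (Follows X) ∧ ∃ u ∈ G, ∃ v ∈ F, u ++ v = w}, ?_, ?_,
      (hR.tsum_append_le (fun w hw => hw) hs).trans (mul_le_one' hGs hsum)⟩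
    · rintro _ ⟨hc, u, hu, v, hv, rfl⟩
      refine ⟨?_, hc⟩
      have := (hG u hu).1
      have := List.length_pos_iff.2 (hF0 v hv)
      rw [List.length_append]
      omega
    · intro x hx
      obtain ⟨u, hu, hxu, hxu'⟩ := hGc x hx
      obtain ⟨v, hv, hxv, hxv'⟩ := hF _ hxu'
      have := hxu.append hxv
      refine ⟨u ++ v, ⟨this.isChain (hX' hx), u, hu, v, hv, rfl⟩, this, ?_⟩
      rwa [List.length_append, tail_add]

/-- A covering family of words gives an upper bound of the dimension of the limit set. -/
theorem IsScaled.dimH_limitSet_le [Finite A] [Nonempty A] (h : Φ.IsScaled lam κ θ L α) {K : ℝ≥0∞}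
    (hR : IsWeight (Follows X) (Φ.weight lam) K θ) (hX : ∀ x ∈ X, ∀ n, tail n x ∈ X)
    {X' : Set (ℕ → A)} (hX' : X' ⊆ X) {F : Set (List A)} (hF0 : ∀ w ∈ F, w ≠ [])
    (hF : Covers F X') {s : ℝ≥0} (hsum : ∑' w : F, Φ.weight lam w ^ (s : ℝ) ≤ 1) :
    dimH (Φ.limitSet X') ≤ s := by
  borelize E
  refine le_of_forall_gt_imp_ge_of_dense fun s' hs' => ?_
  rcases eq_or_ne s' ⊤ with rfl | hst
  · exact le_top
  lift s' to ℝ≥0 using hst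
  have hss : (s : ℝ) < s' := by exact_mod_cast hs'
  have hs'0 : (0 : ℝ) < s' := s.coe_nonneg.trans_lt hss
  -- The choice of `η` gives `(1 - η) * s' = s`, so the `s'`-th powers of the diameters are
  -- controlled by the `s`-th powers of the weights.
  obtain ⟨C, hC, hdiam⟩ := h.exists_ediam_le hR (η := 1 - s / s')
    (by rw [sub_pos, div_lt_one hs'0]; exact hss)
  choose G hG hGc hGs using exists_covers_of_le_length hR hX' hF0 hF s.coe_nonneg hsum
  refine dimH_le_of_hausdorffMeasure_ne_top (ne_top_of_le_ne_top
    (ENNReal.rpow_ne_top_of_nonneg hs'0.le hC : C ^ (s' : ℝ) ≠ ⊤) ?_)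
  have hYt : Metric.ediam Φ.Y ≠ ⊤ := Φ.isCompact_Y.isBounded.ediam_ne_top
  refine (MeasureTheory.Measure.hausdorffMeasure_le_liminf_tsum (ι := fun n => G n) (s' : ℝ) _
    (l := Filter.atTop) (fun n : ℕ => (θ : ℝ≥0∞) ^ n * Metric.ediam Φ.Y) ?_
    (fun n w => Φ.wordMap w '' Φ.domain w) ?_ ?_).trans ?_
  · have h1 := ENNReal.tendsto_pow_atTop_nhds_zero_of_lt_one
      (ENNReal.coe_lt_one_iff.2 h.lt_one)
    simpa using ENNReal.Tendsto.mul_const h1 (Or.inr hYt)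
  · refine Filter.Eventually.of_forall fun n w => Metric.ediam_le ?_
    rintro _ ⟨x, hx, rfl⟩ _ ⟨y, hy, rfl⟩
    obtain ⟨hl, hc⟩ := hG n w w.2
    refine le_trans ?_ (mul_le_mul' (pow_le_pow_of_le_one zero_le
      (ENNReal.coe_lt_one_iff.2 h.lt_one).le hl) (Metric.edist_le_ediam_of_mem hx.1 hy.1))
    rw [edist_dist, edist_dist, ← ENNReal.ofReal_coe_nnreal, ← ENNReal.ofReal_pow θ.coe_nonneg,
      ← ENNReal.ofReal_mul (by positivity)]
    exact ENNReal.ofReal_le_ofReal (h.dist_wordMap_le hc hx hy)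
  · refine Filter.Eventually.of_forall fun n y hy => ?_
    obtain ⟨x, hx, hx', rfl⟩ := mem_limitSet.1 hy
    obtain ⟨w, hw, hxw, -⟩ := hGc n x hx'
    obtain ⟨h1, h2⟩ := Φ.coding_eq_wordMap hX hx hxw
    exact mem_iUnion.2 ⟨⟨w, hw⟩, _, h2, h1.symm⟩
  · refine (Filter.liminf_le_liminf (v := fun _ => C ^ (s' : ℝ))
      (Filter.Eventually.of_forall fun n => ?_)).trans (Filter.liminf_const _).le
    calc ∑' w : G n, Metric.ediam (Φ.wordMap w '' Φ.domain w) ^ (s' : ℝ)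
        ≤ ∑' w : G n, C ^ (s' : ℝ) * Φ.weight lam w ^ (s : ℝ) := by
          refine ENNReal.tsum_le_tsum fun w => ?_
          refine (ENNReal.rpow_le_rpow (hdiam w (hG n w w.2).2) hs'0.le).trans ?_
          rw [ENNReal.mul_rpow_of_nonneg _ _ hs'0.le, ← ENNReal.rpow_mul]
          have : (1 - (1 - (s : ℝ) / s')) * s' = s := by field_simp; ring
          rw [this]
      _ ≤ C ^ (s' : ℝ) := by
          rw [ENNReal.tsum_mul_left]
          exact mul_le_of_le_one_right zero_le (hGs n)

end Metric

/-! ### The open set condition and volume packing. -/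

section Volume

open MeasureTheory

variable {A : Type*} {X : Set (ℕ → A)} {d : ℕ} {Φ : Construction X (EuclideanSpace ℝ (Fin d))}
  {lam : A → EuclideanSpace ℝ (Fin d) → ℝ} {κ : ℝ} {θ : ℝ≥0} {L α : ℝ}

theorem IsConformal.wordMap_mem_interior (hΦ : Φ.IsConformal) {a : A} {w : List A}
    (hw : (a :: w).IsChain (Follows X)) {x : EuclideanSpace ℝ (Fin d)}
    (hx : ∀ e ∈ (a :: w).getLast?, x ∈ interior (Φ.piece e)) :
    Φ.wordMap w x ∈ interior (Φ.piece a) := by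
  induction w generalizing a with
  | nil => exact hx a (by simp)
  | cons b w ih =>
    obtain ⟨hab, hw'⟩ := List.isChain_cons_cons.1 hw
    have hx' := ih hw' (by simpa using hx)
    refine interior_maximal ?_ (hΦ.isOpen_image b) (mem_image_of_mem _ hx')
    exact (image_mono interior_subset).trans (Φ.mapsTo_piece a b hab).image_subset

/-- The images of the interiors under incomparable words are disjoint. -/
theorem IsConformal.wordMap_ne (hΦ : Φ.IsConformal) {u v : List A}
    (hu : u.IsChain (Follows X)) (hv : v.IsChain (Follows X)) (huv : ¬ u <+: v) (hvu : ¬ v <+: u)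
    {x y : EuclideanSpace ℝ (Fin d)} (hx : ∀ e ∈ u.getLast?, x ∈ interior (Φ.piece e))
    (hy : ∀ e ∈ v.getLast?, y ∈ interior (Φ.piece e)) :
    Φ.wordMap u x ≠ Φ.wordMap v y := by
  induction u generalizing v with
  | nil => exact absurd List.nil_prefix huv
  | cons a u ih =>
    cases v with
    | nil => exact absurd List.nil_prefix hvu
    | cons b v =>
      have hxa := hΦ.wordMap_mem_interior hu hx
      have hyb := hΦ.wordMap_mem_interior hv hy
      rcases eq_or_ne a b with rfl | hab
      · rw [List.prefix_cons_inj] at huv hvu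
        intro heq
        have hne : ∀ w z : List A, ¬ w <+: z → w ≠ [] := by
          rintro _ z h rfl
          exact h List.nil_prefix
        refine ih hu.tail hv.tail huv hvu ?_ ?_
          (Φ.injOn_φ a (interior_subset hxa) (interior_subset hyb) heq)
        · intro e he
          refine hx e ?_
          rw [show a :: u = [a] ++ u from rfl, List.getLast?_append_of_ne_nil _ (hne _ _ huv)]
          exact he
        · intro e he
          refine hy e ?_
          rw [show a :: v = [a] ++ v from rfl, List.getLast?_append_of_ne_nil _ (hne _ _ hvu)]
          exact he
      · exact (hΦ.openSet a b hab).ne_of_mem (mem_image_of_mem _ hxa) (mem_image_of_mem _ hyb)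

theorem isAddHaarMeasure_hausdorffMeasure_euclideanSpace :
    (μH[(d : ℝ)] : Measure (EuclideanSpace ℝ (Fin d))).IsAddHaarMeasure := by
  simpa using isAddHaarMeasure_hausdorffMeasure (E := EuclideanSpace ℝ (Fin d))

-- Each piece contains a ball in its interior, of a common radius since `A` is finite. On it the
-- inverse of the composition is Lipschitz with constant `K / R ^ (1 + η)`, so the image cannot have
-- small volume.
open Filter Topology in
theorem IsConformal.exists_volume [Finite A] [Nonempty A] (hΦ : Φ.IsConformal)
    (h : Φ.IsScaled lam κ θ L α) {K : ℝ≥0∞}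
    (hR : IsWeight (Follows X) (Φ.weight lam) K θ)
    (hK : ∀ w : List A, w.IsChain (Follows X) → ∀ x ∈ Φ.domain w,
      Φ.weight lam w ≤ K * ENNReal.ofReal (Φ.scale lam w x)) {η : ℝ} (hη : 0 < η) :
    ∃ (B : A → Set (EuclideanSpace ℝ (Fin d))) (b : ℝ≥0∞), b ≠ 0 ∧ b ≠ ⊤ ∧
      ∀ e, IsCompact (B e) ∧ B e ⊆ interior (Φ.piece e) ∧
        ∀ w : List A, w.IsChain (Follows X) → e ∈ w.getLast? →
          b * Φ.weight lam w ^ ((1 + η) * d) ≤ K ^ (d : ℝ) * μH[(d : ℝ)] (Φ.wordMap w '' B e) := by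
  have := isAddHaarMeasure_hausdorffMeasure_euclideanSpace (d := d)
  obtain ⟨δ, hδ0, hδ⟩ := h.exists_mul_edist_le hR hK hη
  choose z hz using hΦ.nonempty_interior
  obtain ⟨ρ, hρ, hρ0, hρδ⟩ : ∃ ρ : ℝ, (∀ e, Metric.closedBall (z e) ρ ⊆ interior (Φ.piece e)) ∧
      -- Radius at most `δ / 2` keeps any two points of a ball within the scale `δ`.
      0 < ρ ∧ ρ ≤ δ / 2 := by
    have : ∀ e, ∀ᶠ ρ in 𝓝[>] (0 : ℝ), Metric.closedBall (z e) ρ ⊆ interior (Φ.piece e) :=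
      fun e => by
        obtain ⟨ρ, h0, h1⟩ := Metric.nhds_basis_closedBall.mem_iff.1
          (isOpen_interior.mem_nhds (hz e))
        filter_upwards [Ioc_mem_nhdsGT h0] with ρ' hρ'
        exact (Metric.closedBall_subset_closedBall hρ'.2).trans h1
    obtain ⟨ρ, h1, h2⟩ := ((eventually_all.2 this).and (Ioc_mem_nhdsGT (half_pos hδ0))).exists
    exact ⟨ρ, h1, h2⟩
  refine ⟨fun e => Metric.closedBall (z e) ρ,
    μH[(d : ℝ)] (Metric.closedBall (0 : EuclideanSpace ℝ (Fin d)) ρ),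
    (Metric.measure_closedBall_pos _ _ hρ0).ne', measure_closedBall_lt_top.ne, fun e =>
      ⟨isCompact_closedBall _ _, hρ e, fun w hw he => ?_⟩⟩
  set B := Metric.closedBall (z e) ρ with hB
  set R := Φ.weight lam w with hRw
  have hR0 : R ^ (1 + η) ≠ 0 := by
    rw [Ne, ENNReal.rpow_eq_zero_iff]
    simp [hR.ne_zero w hw, hR.ne_top' hw, hRw]
  have hRt : R ^ (1 + η) ≠ ⊤ := ENNReal.rpow_ne_top_of_nonneg (by linarith) (hR.ne_top' hw)
  have hBdom : B ⊆ Φ.domain w := fun x hx => by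
    refine ⟨Φ.piece_subset e (interior_subset (hρ e hx)), fun f hf => ?_⟩
    obtain rfl : e = f := by
      rw [Option.mem_def] at he hf
      exact Option.some_injective _ (he.symm.trans hf)
    exact interior_subset (hρ e hx)
  have hball : ∀ x ∈ B, ∀ y ∈ B, R ^ (1 + η) * edist x y ≤
      K * edist (Φ.wordMap w x) (Φ.wordMap w y) := fun x hx y hy => by
    refine hδ w hw x (hBdom hx) y (hBdom hy) ?_
    have h1 := dist_triangle_right x y (z e)
    have h2 := Metric.mem_closedBall.1 hx
    have h3 := Metric.mem_closedBall.1 hy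
    linarith
  have hinj : InjOn (Φ.wordMap w) B := (injOn_wordMap hw).mono hBdom
  set g := Function.invFunOn (Φ.wordMap w) B
  have hg : LeftInvOn g (Φ.wordMap w) B := hinj.leftInvOn_invFunOn
  set K' := K / R ^ (1 + η) with hK'
  have hK't : K' ≠ ⊤ := ENNReal.div_ne_top hR.ne_top hR0
  have hlip : LipschitzOnWith K'.toNNReal g (Φ.wordMap w '' B) := by
    rintro _ ⟨x, hx, rfl⟩ _ ⟨y, hy, rfl⟩
    rw [hg hx, hg hy, ENNReal.coe_toNNReal hK't, hK', div_eq_mul_inv, mul_right_comm,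
      ← div_eq_mul_inv, ENNReal.le_div_iff_mul_le (Or.inl hR0) (Or.inl hRt), mul_comm]
    exact hball x hx y hy
  have hvol := hlip.hausdorffMeasure_image_le (d := d) (Nat.cast_nonneg d)
  rw [ENNReal.coe_toNNReal hK't, hg.image_image] at hvol
  have hc : μH[(d : ℝ)] (Metric.closedBall (0 : EuclideanSpace ℝ (Fin d)) ρ) = μH[(d : ℝ)] B :=
    (Measure.addHaar_closedBall_center _ _ _).symm
  rw [hc, ENNReal.rpow_mul]
  refine (mul_le_mul_left hvol _).trans_eq ?_
  rw [mul_right_comm, ← ENNReal.mul_rpow_of_nonneg _ _ (Nat.cast_nonneg d), hK',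
    ENNReal.div_mul_cancel hR0 hRt]

/-- The weights of incomparable words of comparable scale whose cylinders meet a set of that
scale. -/
theorem IsConformal.exists_tsum_le [Finite A] [Nonempty A] (hΦ : Φ.IsConformal)
    (h : Φ.IsScaled lam κ θ L α) {K : ℝ≥0∞}
    (hR : IsWeight (Follows X) (Φ.weight lam) K θ)
    (hK : ∀ w : List A, w.IsChain (Follows X) → ∀ x ∈ Φ.domain w,
      Φ.weight lam w ≤ K * ENNReal.ofReal (Φ.scale lam w x)) {t t' : ℝ} (ht : 0 ≤ t)
    (htt : t' < t) {K₁ : ℝ≥0∞} (hK₁ : K₁ ≠ ⊤) :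
    ∃ C : ℝ≥0∞, C ≠ ⊤ ∧ ∀ ρ : ℝ≥0∞, ρ ≠ 0 → ρ ≤ 1 → ∀ U : Set (EuclideanSpace ℝ (Fin d)),
      Metric.ediam U ≤ ρ → ∀ F : Set (List A), (∀ w ∈ F, w ≠ [] ∧ w.IsChain (Follows X) ∧
        Φ.weight lam w ≤ ρ ∧ ρ ≤ K₁ * Φ.weight lam w ∧ (Φ.wordMap w '' Φ.domain w ∩ U).Nonempty) →
      (∀ u ∈ F, ∀ v ∈ F, u <+: v → u = v) → ∑' w : F, Φ.weight lam w ^ t ≤ C * ρ ^ t' := by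
  have := isAddHaarMeasure_hausdorffMeasure_euclideanSpace (d := d)
  have := hΦ.nontrivial
  have hd : (0 : ℝ) < d := by
    have := Module.finrank_pos (R := ℝ) (M := EuclideanSpace ℝ (Fin d))
    rw [finrank_euclideanSpace_fin] at this
    exact_mod_cast this
  -- Volume and diameter each lose `η * d` in the exponent, so `2 * η * d` must fit into `t - t'`.
  obtain ⟨η, hη0, hη1, hηt⟩ : ∃ η : ℝ, 0 < η ∧ η ≤ 1 ∧ 2 * η * d ≤ t - t' := by
    refine ⟨min 1 ((t - t') / (2 * d)), lt_min one_pos ?_, min_le_left _ _, ?_⟩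
    · have := sub_pos.2 htt
      positivity
    · calc 2 * min 1 ((t - t') / (2 * d)) * d ≤ 2 * ((t - t') / (2 * d)) * d := by
            gcongr
            exact min_le_right _ _
        _ = t - t' := by field_simp
  obtain ⟨B, b, hb0, hbt, hB⟩ := hΦ.exists_volume h hR hK hη0
  obtain ⟨C, hC, hdiam⟩ := h.exists_ediam_le hR hη0
  set V := μH[(d : ℝ)] (Metric.ball (0 : EuclideanSpace ℝ (Fin d)) 1) with hV
  have hVt : V ≠ ⊤ := measure_ball_lt_top.ne
  set e₁ : ℝ := (1 + η) * d with he₁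
  have he₁0 : 0 ≤ e₁ := by positivity
  set C₁ := K ^ (d : ℝ) * ((1 + C) ^ (d : ℝ) * V) / b with hC₁
  have hC₁t : C₁ ≠ ⊤ := by
    refine ENNReal.div_ne_top (ENNReal.mul_ne_top ?_ (ENNReal.mul_ne_top ?_ hVt)) hb0
    · exact ENNReal.rpow_ne_top_of_nonneg hd.le hR.ne_top
    · exact ENNReal.rpow_ne_top_of_nonneg hd.le (by simp [hC])
  refine ⟨K₁ ^ e₁ * C₁, ENNReal.mul_ne_top (ENNReal.rpow_ne_top_of_nonneg he₁0 hK₁) hC₁t,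
    fun ρ hρ0 hρ1 U hU F hF hFp => ?_⟩
  have hρt : ρ ≠ ⊤ := (hρ1.trans_lt ENNReal.one_lt_top).ne
  rcases F.eq_empty_or_nonempty with rfl | ⟨w₀, hw₀⟩
  · simp
  obtain ⟨x₀, -, hx₀⟩ := (hF w₀ hw₀).2.2.2.2
  let B' : F → Set (EuclideanSpace ℝ (Fin d)) := fun w =>
    Φ.wordMap w '' B ((w : List A).getLast (hF w w.2).1)
  have hlast : ∀ w : F, (w : List A).getLast (hF w w.2).1 ∈ (w : List A).getLast? := fun w =>
    List.getLast?_eq_some_getLast _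
  have hint : ∀ (w : F), ∀ x ∈ B ((w : List A).getLast (hF w w.2).1),
      ∀ e ∈ (w : List A).getLast?, x ∈ interior (Φ.piece e) := by
    intro w x hx e he
    have h1 := hlast w
    rw [Option.mem_def] at h1 he
    rw [← Option.some_injective _ (h1.symm.trans he)]
    exact (hB _).2.1 hx
  have hdom : ∀ (w : F), B ((w : List A).getLast (hF w w.2).1) ⊆ Φ.domain w := fun w x hx =>
    ⟨Φ.piece_subset _ (interior_subset ((hB _).2.1 hx)),
      fun e he => interior_subset (hint w x hx e he)⟩
  have hdisj : Pairwise (Function.onFun Disjoint B') := by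
    intro u v huv
    rw [Function.onFun, Set.disjoint_left]
    rintro _ ⟨x, hx, rfl⟩ ⟨y, hy, hxy⟩
    refine hΦ.wordMap_ne (hF u u.2).2.1 (hF v v.2).2.1 ?_ ?_ (hint u x hx) (hint v y hy) hxy.symm
    · exact fun hp => huv (Subtype.ext (hFp u u.2 v v.2 hp))
    · exact fun hp => huv (Subtype.ext (hFp v v.2 u u.2 hp).symm)
  have hmeas : ∀ w, MeasurableSet (B' w) := by
    intro w
    refine ((hB _).1.image_of_continuousOn ?_).isClosed.measurableSet
    refine LipschitzOnWith.continuousOn (K := θ ^ (w : List A).length)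
      (LipschitzOnWith.of_dist_le_mul fun x hx y hy => ?_)
    rw [NNReal.coe_pow]
    exact h.dist_wordMap_le (hF w w.2).2.1 (hdom w hx) (hdom w hy)
  have hr : ρ + C * ρ ^ (1 - η) ≤ (1 + C) * ρ ^ (1 - η) := by
    rw [add_mul, one_mul]
    gcongr
    conv_lhs => rw [← ENNReal.rpow_one ρ]
    exact ENNReal.rpow_le_rpow_of_exponent_ge hρ1 (by linarith)
  set r := (1 + C) * ρ ^ (1 - η) with hrdef
  have hrt : r ≠ ⊤ := ENNReal.mul_ne_top (by simp [hC])
    (ENNReal.rpow_ne_top_of_nonneg (by linarith) hρt)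
  have hsub : (⋃ w, B' w) ⊆ Metric.closedBall x₀ r.toReal := by
    refine iUnion_subset fun w => ?_
    rintro _ ⟨x, hx, rfl⟩
    obtain ⟨p, hp, hpU⟩ := (hF w w.2).2.2.2.2
    rw [Metric.mem_closedBall, dist_edist]
    refine ENNReal.toReal_mono hrt (le_trans ?_ hr)
    refine (edist_triangle _ p _).trans ?_
    rw [add_comm]
    refine add_le_add ((Metric.edist_le_ediam_of_mem hpU hx₀).trans hU) ?_
    refine (Metric.edist_le_ediam_of_mem (mem_image_of_mem _ (hdom w hx)) hp).trans ?_
    refine (hdiam w (hF w w.2).2.1).trans ?_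
    exact mul_le_mul_right (ENNReal.rpow_le_rpow (hF w w.2).2.2.1 (by linarith)) _
  -- Packing: the disjoint images all lie in one ball of radius `r`, comparable to `ρ ^ (1 - η)`.
  have hvol : b * ∑' w : F, Φ.weight lam w ^ e₁ ≤
      K ^ (d : ℝ) * ((1 + C) ^ (d : ℝ) * V) * ρ ^ ((1 - η) * d) := by
    calc b * ∑' w : F, Φ.weight lam w ^ e₁ ≤ ∑' w : F, K ^ (d : ℝ) * μH[(d : ℝ)] (B' w) := by
          rw [← ENNReal.tsum_mul_left]
          exact ENNReal.tsum_le_tsum fun w => (hB _).2.2 w (hF w w.2).2.1 (hlast w)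
      _ = K ^ (d : ℝ) * μH[(d : ℝ)] (⋃ w, B' w) := by
          rw [ENNReal.tsum_mul_left, measure_iUnion hdisj hmeas]
      _ ≤ K ^ (d : ℝ) * (r ^ (d : ℝ) * V) := by
          gcongr
          refine (measure_mono hsub).trans ?_
          rw [Measure.addHaar_closedBall _ _ ENNReal.toReal_nonneg, finrank_euclideanSpace_fin,
            ENNReal.ofReal_pow ENNReal.toReal_nonneg, ENNReal.ofReal_toReal hrt,
            ENNReal.rpow_natCast]
      _ = _ := by
          rw [hrdef, ENNReal.mul_rpow_of_nonneg _ _ hd.le, ← ENNReal.rpow_mul]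
          ring
  have hS : ∑' w : F, Φ.weight lam w ^ e₁ ≤ C₁ * ρ ^ ((1 - η) * d) := by
    rw [hC₁, div_eq_mul_inv, mul_right_comm, ← div_eq_mul_inv,
      ENNReal.le_div_iff_mul_le (Or.inl hb0) (Or.inl hbt), mul_comm]
    exact hvol
  calc ∑' w : F, Φ.weight lam w ^ t
      ≤ ∑' w : F, K₁ ^ e₁ * ρ ^ (t - e₁) * Φ.weight lam w ^ e₁ := by
        refine ENNReal.tsum_le_tsum fun w => ?_
        -- Passing through `ρ` is needed because `t - e₁` may be negative.
        calc Φ.weight lam w ^ t ≤ ρ ^ t := ENNReal.rpow_le_rpow (hF w w.2).2.2.1 ht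
          _ = ρ ^ (t - e₁) * ρ ^ e₁ := by rw [← ENNReal.rpow_add _ _ hρ0 hρt, sub_add_cancel]
          _ ≤ ρ ^ (t - e₁) * (K₁ * Φ.weight lam w) ^ e₁ := by
              gcongr
              exact (hF w w.2).2.2.2.1
          _ = _ := by
              rw [ENNReal.mul_rpow_of_nonneg _ _ he₁0]
              ring
    _ ≤ K₁ ^ e₁ * ρ ^ (t - e₁) * (C₁ * ρ ^ ((1 - η) * d)) := by
        rw [ENNReal.tsum_mul_left]
        gcongr
    _ = K₁ ^ e₁ * C₁ * (ρ ^ (t - e₁) * ρ ^ ((1 - η) * d)) := by ring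
    _ ≤ _ := by
        gcongr
        rw [← ENNReal.rpow_add _ _ hρ0 hρt]
        refine ENNReal.rpow_le_rpow_of_exponent_ge hρ1 ?_
        rw [he₁]
        linarith

end Volume

end Construction

/-! ### Words stopped at a given weight. -/

/-- The words at which the weight first drops to `ρ`. -/
def stoppingWords {A : Type*} (r : A → A → Prop) (R : List A → ℝ≥0∞) (ρ : ℝ≥0∞) : Set (List A) :=
  {w | w ≠ [] ∧ w.IsChain r ∧ R w ≤ ρ ∧ ρ < R w.dropLast}

section Stopping

variable {A : Type*} {r : A → A → Prop} {R : List A → ℝ≥0∞} {K θ ρ : ℝ≥0∞}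

/-- If `v` properly extended `u`, then `v.dropLast` would still extend `u` and have weight at most
`ρ`, contrary to stopping at `v`. -/
theorem IsWeight.eq_of_prefix (h : IsWeight r R K θ) {u v : List A}
    (hu : u ∈ stoppingWords r R ρ) (hv : v ∈ stoppingWords r R ρ) (huv : u <+: v) : u = v := by
  obtain ⟨z, rfl⟩ := huv
  rcases eq_or_ne z [] with rfl | hz
  · simp
  · exfalso
    have h1 := hv.2.2.2
    rw [List.dropLast_append_of_ne_nil hz] at h1
    have hc : (u ++ z.dropLast).IsChain r := by
      refine hv.2.1.prefix ?_
      exact List.prefix_append_right_inj u |>.2 (List.dropLast_prefix z)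
    refine (h1.trans_le ((h.append_le _ _ hc).trans ?_)).not_ge hu.2.2.1
    exact mul_le_of_le_one_right zero_le (h.le_one (List.isChain_append.1 hc).2.1)

/-- The last letter lowers the weight by a factor of at least `κ / K`, so the weight cannot drop far
below `ρ`. -/
theorem IsWeight.le_mul_of_mem_stoppingWords (h : IsWeight r R K θ) {κ : ℝ≥0∞} (hκ0 : κ ≠ 0)
    (hκt : κ ≠ ⊤) (hκ : ∀ e, κ ≤ R [e]) {w : List A} (hw : w ∈ stoppingWords r R ρ) :
    ρ ≤ K / κ * R w := by
  have h1 := h.le_append w.dropLast [w.getLast hw.1]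
    (by rw [List.dropLast_append_getLast]; exact hw.2.1)
  rw [List.dropLast_append_getLast] at h1
  rw [div_eq_mul_inv, mul_right_comm, ← div_eq_mul_inv,
    ENNReal.le_div_iff_mul_le (Or.inl hκ0) (Or.inl hκt)]
  exact (mul_le_mul' hw.2.2.2.le (hκ _)).trans h1

theorem IsWeight.exists_stoppingWord {X : Set (ℕ → A)} (h : IsWeight (Follows X) R K θ)
    {x : ℕ → A} (hx : x ∈ X) (hρ0 : ρ ≠ 0) (hρ1 : ρ < 1) :
    ∃ w ∈ stoppingWords (Follows X) R ρ, StartsWith x w := by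
  have hex : ∃ n, R (firstLetters x n) ≤ ρ := by
    have := (ENNReal.tendsto_pow_atTop_nhds_zero_of_lt_one h.lt_one).eventually_lt_const
      (pos_iff_ne_zero.2 hρ0)
    obtain ⟨n, hn⟩ := this.exists
    refine ⟨n, (h.le_pow _ (isChain_firstLetters hx n)).trans ?_⟩
    rw [length_firstLetters]
    exact hn.le
  classical
  obtain ⟨n, hn⟩ : ∃ n, Nat.find hex = n + 1 := by
    refine Nat.exists_eq_succ_of_ne_zero fun h0 => ?_
    have := Nat.find_spec hex
    rw [h0] at this
    simp only [firstLetters, List.ofFn_zero, h.nil] at this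
    exact hρ1.not_ge this
  have hlast : (firstLetters x (n + 1)).dropLast = firstLetters x n := by
    rw [firstLetters_add]
    simp [firstLetters]
  refine ⟨firstLetters x (n + 1), ⟨?_, isChain_firstLetters hx _, ?_, ?_⟩,
    startsWith_firstLetters _ _⟩
  · intro h0
    have := congrArg List.length h0
    simp at this
  · rw [← hn]
    exact Nat.find_spec hex
  · rw [hlast]
    exact not_le.1 (Nat.find_min hex (by omega))

end Stopping

/-! ### From Hausdorff covers to finite families of words, and recurrence. -/

namespace Construction

open MeasureTheory

variable {A : Type*} {X : Set (ℕ → A)}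

theorem exists_cover_of_hausdorffMeasure_eq_zero {E : Type*} [MetricSpace E] [MeasurableSpace E]
    [BorelSpace E] {J : Set E} {t : ℝ} (ht : 0 < t) (hJ : μH[t] J = 0) {ε : ℝ≥0∞} (hε : ε ≠ 0) :
    ∃ (U : ℕ → Set E) (ρ : ℕ → ℝ≥0∞), J ⊆ ⋃ n, U n ∧
      (∀ n, ρ n ≠ 0 ∧ ρ n < 1 ∧ Metric.ediam (U n) ≤ ρ n) ∧ ∑' n, ρ n ^ t < ε := by
  have hε2 : ε / 2 ≠ 0 := (ENNReal.half_pos hε).ne'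
  rw [Measure.hausdorffMeasure_apply] at hJ
  have h1 := ENNReal.iSup_eq_zero.1 (ENNReal.iSup_eq_zero.1 hJ 2⁻¹) (by simp)
  have h2 := h1.trans_lt (pos_iff_ne_zero.2 hε2)
  simp only [iInf_lt_iff] at h2
  obtain ⟨U, hU, hdiam, hsum⟩ := h2
  obtain ⟨ε', hε'0, hε's⟩ := ENNReal.exists_pos_sum_of_countable hε2 ℕ
  -- A set of diameter zero still needs a positive scale, so a summable quantity is added; the cap
  -- `2⁻¹` keeps the scale below `1`.
  refine ⟨U, fun n => max (Metric.ediam (U n)) (min 2⁻¹ ((ε' n : ℝ≥0∞) ^ t⁻¹)), hU, fun n =>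
    ⟨?_, ?_, le_max_left _ _⟩, ?_⟩
  · refine (lt_max_of_lt_right (lt_min (by simp) ?_)).ne'
    exact ENNReal.rpow_pos (by exact_mod_cast hε'0 n) ENNReal.coe_ne_top
  · have : (2⁻¹ : ℝ≥0∞) < 1 := by simp
    exact max_lt ((hdiam n).trans_lt this) ((min_le_left _ _).trans_lt this)
  · calc ∑' n, max (Metric.ediam (U n)) (min 2⁻¹ ((ε' n : ℝ≥0∞) ^ t⁻¹)) ^ t
        ≤ ∑' n, ((⨆ _ : (U n).Nonempty, Metric.ediam (U n) ^ t) + ε' n) := by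
          refine ENNReal.tsum_le_tsum fun n => ?_
          rw [(ENNReal.monotone_rpow_of_nonneg ht.le).map_max]
          refine max_le (le_add_right ?_) (le_add_left ?_)
          · rcases (U n).eq_empty_or_nonempty with h | h
            · simp [h, ht]
            · exact le_iSup (fun _ : (U n).Nonempty => Metric.ediam (U n) ^ t) h
          · refine (ENNReal.rpow_le_rpow (min_le_right _ _) ht.le).trans_eq ?_
            rw [← ENNReal.rpow_mul, inv_mul_cancel₀ ht.ne', ENNReal.rpow_one]
      _ < ε / 2 + ε / 2 := by
          rw [ENNReal.tsum_add]
          exact ENNReal.add_lt_add hsum hε's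
      _ = ε := ENNReal.add_halves ε

theorem isOpen_setOf_startsWith [TopologicalSpace A] [DiscreteTopology A] (w : List A) :
    IsOpen {x : ℕ → A | StartsWith x w} := by
  have h := (isClosed_setOf_firstLetters_mem {w}ᶜ 0 w.length).isOpen_compl
  convert h using 1
  ext x
  simp [StartsWith, tail_zero]

section

variable {d : ℕ} {Φ : Construction X (EuclideanSpace ℝ (Fin d))}
  {lam : A → EuclideanSpace ℝ (Fin d) → ℝ} {κ : ℝ} {θ : ℝ≥0} {L α : ℝ} {K : ℝ≥0∞}

/-- A closed subset with limit set of dimension less than `t` has a finite covering family of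
words of small total weight. -/
theorem IsConformal.exists_finset_cover [Finite A] [Nonempty A] [TopologicalSpace A]
    [DiscreteTopology A] (hΦ : Φ.IsConformal) (h : Φ.IsScaled lam κ θ L α)
    (hR : IsWeight (Follows X) (Φ.weight lam) K θ)
    (hK : ∀ w : List A, w.IsChain (Follows X) → ∀ x ∈ Φ.domain w,
      Φ.weight lam w ≤ K * ENNReal.ofReal (Φ.scale lam w x))
    (hX : ∀ x ∈ X, ∀ n, tail n x ∈ X) {X' : Set (ℕ → A)} (hX' : X' ⊆ X) (hclosed : IsClosed X')
    {t : ℝ≥0} (ht : dimH (Φ.limitSet X') < t) :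
    ∃ F : Finset (List A), (∀ w ∈ F, w ≠ []) ∧ (∀ x ∈ X', ∃ w ∈ F, StartsWith x w) ∧
      ∑ w ∈ F, Φ.weight lam w ^ (t : ℝ) < 1 := by
  obtain ⟨t', ht', htt'⟩ := ENNReal.lt_iff_exists_nnreal_btwn.1 ht
  have htt : (t' : ℝ) < t := by exact_mod_cast htt'
  have ht'0 : (0 : ℝ) < t' := by exact_mod_cast zero_le.trans_lt ht'
  have hμ := hausdorffMeasure_of_dimH_lt ht'
  have hκ0 : ENNReal.ofReal κ ≠ 0 := (ENNReal.ofReal_pos.2 h.pos).ne'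
  obtain ⟨C, hC, hcount⟩ := hΦ.exists_tsum_le h hR hK t.coe_nonneg htt
    (K₁ := K / ENNReal.ofReal κ) (ENNReal.div_ne_top hR.ne_top hκ0)
  obtain ⟨U, ρ, hU, hρ, hsum⟩ := exists_cover_of_hausdorffMeasure_eq_zero ht'0 hμ
    (ε := (C + 1)⁻¹) (ENNReal.inv_ne_zero.2 (by simp [hC]))
  -- Each covering set `U n` is replaced by the words stopped at its scale whose images meet it;
  -- packing turns the `t'`-sum of scales into a `t`-sum of weights.
  let G : ℕ → Set (List A) := fun n =>
    {w ∈ stoppingWords (Follows X) (Φ.weight lam) (ρ n) |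
      (Φ.wordMap w '' Φ.domain w ∩ U n).Nonempty}
  have hκR : ∀ e, ENNReal.ofReal κ ≤ Φ.weight lam [e] := fun e => by
    obtain ⟨x, hx⟩ := Φ.nonempty_domain [e]
    refine le_trans (ENNReal.ofReal_le_ofReal ?_) (IsScaled.scale_le_weight hx)
    simpa using h.pow_le_scale (List.isChain_singleton e) hx
  have hG : ∀ n, ∑' w : G n, Φ.weight lam w ^ (t : ℝ) ≤ C * ρ n ^ (t' : ℝ) := fun n =>
    hcount (ρ n) (hρ n).1 (hρ n).2.1.le (U n) (hρ n).2.2 (G n)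
      (fun w hw => ⟨hw.1.1, hw.1.2.1, hw.1.2.2.1,
        hR.le_mul_of_mem_stoppingWords hκ0 ENNReal.ofReal_ne_top hκR hw.1, hw.2⟩)
      fun u hu v hv huv => hR.eq_of_prefix hu.1 hv.1 huv
  have hcover : X' ⊆ ⋃ w : ⋃ n, G n, {x | StartsWith x w} := by
    intro x hx
    obtain ⟨n, hn⟩ := mem_iUnion.1 (hU (mem_limitSet.2 ⟨x, hX' hx, hx, rfl⟩))
    obtain ⟨w, hw, hxw⟩ := hR.exists_stoppingWord (hX' hx) (hρ n).1 (hρ n).2.1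
    obtain ⟨h1, h2⟩ := Φ.coding_eq_wordMap hX (hX' hx) hxw
    refine mem_iUnion.2 ⟨⟨w, mem_iUnion.2 ⟨n, hw, _, ⟨_, h2, rfl⟩, ?_⟩⟩, hxw⟩
    rwa [← h1]
  -- Cylinders are open and `X'` is compact, so finitely many words suffice.
  obtain ⟨F, hF⟩ := hclosed.isCompact.elim_finite_subcover
    (fun w : ⋃ n, G n => {x | StartsWith x (w : List A)})
    (fun w => isOpen_setOf_startsWith _) hcover
  refine ⟨F.map (Function.Embedding.subtype _), fun w hw => ?_, fun x hx => ?_, ?_⟩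
  · obtain ⟨w, -, rfl⟩ := Finset.mem_map.1 hw
    obtain ⟨n, hn⟩ := mem_iUnion.1 w.2
    exact hn.1.1
  · obtain ⟨w, hw, hxw⟩ := mem_iUnion₂.1 (hF hx)
    exact ⟨w, Finset.mem_map_of_mem _ hw, hxw⟩
  · rw [Finset.sum_map]
    calc ∑ w ∈ F, Φ.weight lam w ^ (t : ℝ) ≤ ∑' w : ⋃ n, G n, Φ.weight lam w ^ (t : ℝ) :=
          ENNReal.sum_le_tsum F
      _ ≤ ∑' n, ∑' w : G n, Φ.weight lam w ^ (t : ℝ) :=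
          ENNReal.tsum_iUnion_le_tsum (fun w => Φ.weight lam w ^ (t : ℝ)) G
      _ ≤ ∑' n, C * ρ n ^ (t' : ℝ) := ENNReal.tsum_le_tsum hG
      _ ≤ (C + 1) * ∑' n, ρ n ^ (t' : ℝ) := by
          rw [ENNReal.tsum_mul_left]
          gcongr
          exact le_self_add
      _ < 1 := by
          have hC0 : C + 1 ≠ 0 := by simp
          have hCt : C + 1 ≠ ⊤ := by simp [hC]
          exact ((ENNReal.mul_lt_mul_iff_right hC0 hCt).2 hsum).trans_eq
            (ENNReal.mul_inv_cancel hC0 hCt)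

end

section

variable {E : Type*} [MetricSpace E] {Φ : Construction X E}
  {lam : A → E → ℝ} {κ : ℝ} {θ : ℝ≥0} {L α : ℝ} {K : ℝ≥0∞}

/-- The points that start with `a` and contain `a` infinitely often. -/
def recurrentPoints (X : Set (ℕ → A)) (a : A) : Set (ℕ → A) :=
  {x ∈ X | x 0 = a ∧ ∀ N, ∃ n ≥ N, x n = a}

/-- Cut at a return to `a` at time at least `n₀`: the part before it is a loop, and the rest is
again recurrent. -/
theorem covers_recurrentPoints (hX : ∀ x ∈ X, ∀ n, tail n x ∈ X) (a : A) {n₀ : ℕ} (hn₀ : 0 < n₀) :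
    Covers {w | IsLoop (Follows X) a w ∧ n₀ ≤ w.length} (recurrentPoints X a) := by
  rintro x ⟨hx, hx0, hinf⟩
  obtain ⟨n, hn, hxn⟩ := hinf n₀
  obtain ⟨m, rfl⟩ : ∃ m, n = m + 1 := Nat.exists_eq_succ_of_ne_zero (by omega)
  refine ⟨firstLetters x (m + 1), ⟨⟨isChain_firstLetters hx _, ?_, fun e he => ?_⟩, by simpa⟩,
    startsWith_firstLetters _ _, ?_⟩
  · rw [firstLetters_succ, hx0, List.head?_cons]
  · have : e = x m := by
      rw [firstLetters_add] at he
      simpa [firstLetters, tail, eq_comm] using he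
    rw [this, ← hxn]
    exact pair_mem_language hx m
  · rw [length_firstLetters]
    refine ⟨hX x hx _, by simpa [tail] using hxn, fun N => ?_⟩
    obtain ⟨k, hk, hxk⟩ := hinf (m + 1 + N)
    exact ⟨k - (m + 1), by omega, by rw [tail, ← hxk]; congr 1; omega⟩

theorem exists_tail_mem_recurrentPoints [Finite A] (hX : ∀ x ∈ X, ∀ n, tail n x ∈ X) {x : ℕ → A}
    (hx : x ∈ X) : ∃ a n, tail n x ∈ recurrentPoints X a := by
  obtain ⟨a, ha⟩ := Finite.exists_infinite_fiber x
  have hinf : ∀ N, ∃ n ≥ N, x n = a := fun N => by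
    obtain ⟨n, hn, hN⟩ := (Set.infinite_coe_iff.1 ha).exists_gt N
    exact ⟨n, hN.le, hn⟩
  obtain ⟨n, -, hn⟩ := hinf 0
  refine ⟨a, n, hX x hx n, by simpa [tail] using hn, fun N => ?_⟩
  obtain ⟨k, hk, hxk⟩ := hinf (n + N)
  exact ⟨k - n, by omega, by rw [tail, ← hxk]; congr 1; omega⟩

/-- Over a finite alphabet every point has a tail starting with a letter that recurs, so the limit
set lies in a countable union of Lipschitz images of the recurrent parts. -/
theorem IsScaled.dimH_limitSet_le_of_recurrentPoints [Finite A] (h : Φ.IsScaled lam κ θ L α)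
    (hX : ∀ x ∈ X, ∀ n, tail n x ∈ X) {s : ℝ≥0∞}
    (hs : ∀ a, dimH (Φ.limitSet (recurrentPoints X a)) ≤ s) : dimH (Φ.limitSet X) ≤ s := by
  have hsub : Φ.limitSet X ⊆ ⋃ p : A × {w : List A // w.IsChain (Follows X)},
      Φ.wordMap p.2 '' (Φ.limitSet (recurrentPoints X p.1) ∩ Φ.domain p.2) := by
    intro y hy
    obtain ⟨x, hx, -, rfl⟩ := mem_limitSet.1 hy
    obtain ⟨a, n, hn⟩ := exists_tail_mem_recurrentPoints hX hx
    obtain ⟨h1, h2⟩ := Φ.coding_eq_wordMap hX hx (startsWith_firstLetters x n)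
    refine mem_iUnion.2 ⟨⟨a, firstLetters x n, isChain_firstLetters hx n⟩, _, ⟨?_, h2⟩, h1.symm⟩
    refine mem_limitSet.2 ⟨_, hX x hx _, ?_, rfl⟩
    rwa [length_firstLetters]
  refine (dimH_mono hsub).trans ?_
  rw [dimH_iUnion]
  refine iSup_le fun p => ?_
  refine (LipschitzOnWith.dimH_image_le (K := θ ^ (p.2 : List A).length)
    (LipschitzOnWith.of_dist_le_mul fun x hx y hy => ?_)).trans
    ((dimH_mono inter_subset_left).trans (hs p.1))
  rw [NNReal.coe_pow]
  exact h.dist_wordMap_le p.2.2 hx.2 hy.2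

/-- Without a rich set, the loop sums of every length are at most `K ^ t`, and the long loops cover
the recurrent points at an exponent `t'` between `t` and the dimension. -/
theorem IsScaled.exists_isRich [Finite A] [Nonempty A] (h : Φ.IsScaled lam κ θ L α)
    (hR : IsWeight (Follows X) (Φ.weight lam) K θ) (hX : ∀ x ∈ X, ∀ n, tail n x ∈ X) {t : ℝ≥0}
    (ht : t < dimH (Φ.limitSet X)) :
    ∃ a W, IsRich (Follows X) (Φ.weight lam) K a t W := by
  by_contra! hno
  obtain ⟨t', ht', htt'⟩ := ENNReal.lt_iff_exists_nnreal_btwn.1 ht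
  have htt : (t : ℝ) < t' := by exact_mod_cast ht'
  refine htt'.not_ge (h.dimH_limitSet_le_of_recurrentPoints hX fun a => ?_)
  have hle : ∀ n, ∑' w : {w | IsLoop (Follows X) a w ∧ w.length = n},
      Φ.weight lam w ^ (t : ℝ) ≤ K ^ (t : ℝ) := fun n => by
    by_contra! hlt
    obtain ⟨W, hW⟩ := IsRich.of_lt_tsum hR t.coe_nonneg hlt
    exact hno a W hW
  obtain ⟨n₀, hn₀, hsum⟩ := hR.exists_tsum_loops_le_one htt
    (ENNReal.rpow_ne_top_of_nonneg t.coe_nonneg hR.ne_top) hle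
  refine h.dimH_limitSet_le hR hX (fun x hx => hx.1) ?_ (covers_recurrentPoints hX a hn₀) hsum
  rintro w ⟨-, hw⟩ rfl
  simp at hw
  omega

end

end Construction

/-! ### The subshift of prescribed dimension. -/

theorem tail_mem_markovChain {A : Type*} {S : Set (A × A)} {x : ℕ → A} (hx : x ∈ markovChain S)
    (n : ℕ) : tail n x ∈ markovChain S := fun k => hx (n + k)

theorem mem_of_follows {A : Type*} {S : Set (A × A)} {e f : A} (h : Follows (markovChain S) e f) :
    (e, f) ∈ S := by
  obtain ⟨x, hx, k, n, hw⟩ := h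
  have hn : n = 1 := by simpa using (congrArg List.length hw).symm
  subst hn
  have : e = x k ∧ f = x (k + 1) := by simpa [List.ofFn_succ] using hw
  rw [this.1, this.2]
  exact hx k

open Construction in
/-- Every value below the dimension of the limit set is attained by a non-empty subshift. -/
theorem exists_subshift_dimH_eq {A : Type*} [Finite A] [Nonempty A] [TopologicalSpace A]
    [DiscreteTopology A] {S : Set (A × A)} {d : ℕ}
    {Φ : Construction (markovChain S) (EuclideanSpace ℝ (Fin d))} (hΦ : Φ.IsConformal) {t : ℝ≥0}
    (ht : t < dimH (Φ.limitSet (markovChain S))) :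
    ∃ X ⊆ markovChain S, IsSubshift X ∧ X.Nonempty ∧ dimH (Φ.limitSet X) = t := by
  have hX : ∀ x ∈ markovChain S, ∀ n, tail n x ∈ markovChain S :=
    fun x hx n => tail_mem_markovChain hx n
  obtain ⟨lam, κ, θ, L, α, h⟩ := hΦ.exists_isScaled
  obtain ⟨K, hR, hK⟩ := h.exists_isWeight
  obtain ⟨a, W₀, hW₀⟩ := h.exists_isRich hR hX ht
  obtain ⟨W, hW, hWsub, hWsum⟩ := hW₀.exists_seq hR t.coe_nonneg
  have hanti : Antitone fun k => factors (W k) := antitone_nat_of_succ_le fun k => by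
    obtain ⟨j, hj⟩ := hWsub k
    exact factors_antitone hj
  have hfac : ∀ k, ∀ u v : List A, v ∈ factors (W k) → u <:+: v → u ∈ factors (W k) :=
    fun k u v hv huv => factors_of_infix hv huv
  set X' := factorShift (⋂ k, factors (W k)) with hX'def
  have hX'k : ∀ k, X' ⊆ factorShift (factors (W k)) := fun k =>
    factorShift_mono (iInter_subset _ k)
  have hX' : X' ⊆ markovChain S := by
    -- Membership in a Markov chain is decided by pairs of letters, so it survives free
    -- concatenation of loops.
    intro x hx n
    have h1 := isChain_of_mem_factors (hW 0).isLoop (hX'k 0 hx n 2)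
    have h2 : Follows (markovChain S) (x n) (x (n + 1)) := by
      simpa [firstLetters, List.ofFn_succ, tail] using h1
    exact mem_of_follows h2
  have hsub : IsSubshift X' := isSubshift_factorShift _
  have hlimit : ∀ F : Finset (List A), (∀ f ∈ F, f ≠ []) →
      ∑ f ∈ F, Φ.weight lam f ^ (t : ℝ) < 1 → ∃ x ∈ X', ∀ f ∈ F, ¬ StartsWith x f :=
    fun F hF0 hF => exists_mem_factorShift_iInter hanti hfac F fun k =>
      (hW k).not_covered hR t.coe_nonneg hF0 hF k
  refine ⟨X', hX', hsub, ?_, le_antisymm ?_ ?_⟩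
  -- The empty family has sum zero, so non-emptiness is a special case of not being covered.
  · obtain ⟨x, hx, -⟩ := hlimit ∅ (by simp) (by simp)
    exact ⟨x, hx⟩
  · have hle : ∀ k : ℕ, dimH (Φ.limitSet X') ≤ ((t + 1 / (k + 1) : ℝ≥0) : ℝ≥0∞) := fun k => by
      have hs := hWsum k
      have hcoe : (t : ℝ) + 1 / (k + 1 : ℝ) = ((t + 1 / (k + 1) : ℝ≥0) : ℝ) := by push_cast; rfl
      rw [hcoe] at hs
      obtain ⟨F, hF0, hFc, hFs⟩ := (hW (k + 1)).exists_covers hR (NNReal.coe_nonneg _) hs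
        (hX'k (k + 1)) fun x hx n => tail_mem_factorShift hx n
      exact h.dimH_limitSet_le hR hX hX' hF0 hFc hFs
    have hlim : Filter.Tendsto (fun k : ℕ => ((t + 1 / (k + 1) : ℝ≥0) : ℝ≥0∞)) Filter.atTop
        (nhds t) := by
      rw [ENNReal.tendsto_coe]
      simpa using (tendsto_one_div_add_atTop_nhds_zero_nat (𝕜 := ℝ≥0)).const_add t
    exact ge_of_tendsto' hlim hle
  · by_contra! hlt
    obtain ⟨F, hF0, hFc, hFs⟩ := hΦ.exists_finset_cover h hR hK hX hX' hsub.1 hlt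
    obtain ⟨x, hx, hxF⟩ := hlimit F hF0 hFs
    obtain ⟨w, hw, hxw⟩ := hFc x hx
    exact hxF w hw hxw

end ShiftGenerated

open ShiftGenerated in
theorem theorem3p4 {A : Type*} [Finite A] [Nontrivial A] [TopologicalSpace A] [DiscreteTopology A]
    (S : Set (A × A)) (d : ℕ)
    (Φ : Construction (markovChain S) (EuclideanSpace ℝ (Fin d))) (hΦ : Φ.IsConformal) :
    {t : ℝ≥0∞ | ∃ X : Set (ℕ → A), X ⊆ markovChain S ∧ IsSubshift X ∧
        ((markovChain S).Nonempty → X.Nonempty) ∧ dimH (Φ.limitSet X) = t} =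
      Icc 0 (dimH (Φ.limitSet (markovChain S))) := by
  ext t
  constructor
  · rintro ⟨X, hX, -, -, rfl⟩
    exact ⟨zero_le, dimH_mono (image_mono fun ω hω => hX hω)⟩
  · rintro ⟨-, ht⟩
    rcases ht.eq_or_lt with rfl | hlt
    -- The right endpoint is attained by the whole Markov chain.
    · exact ⟨_, subset_rfl, isSubshift_markovChain S, id, rfl⟩
    · lift t to ℝ≥0 using hlt.ne_top
      obtain ⟨X, hX, hXs, hne, hdim⟩ := exists_subshift_dimH_eq hΦ hlt
      exact ⟨X, hX, hXs, fun _ => hne, hdim⟩
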